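/- Let $d\in\mathbb N$, write $z=(x,v)\in\mathbb R^d\times\mathbb R^d$, and let $\|\cdot\|$ be the norm of $L^2(\mathbb R^{d}\times\mathbb R^d;\mathbb C)$ and $\|\alpha\|_{W^{1,2}}=(\|\alpha\|^2+\|\nabla_x\alpha\|^2+\|\nabla_v\alpha\|^2)^{1/2}$. Let $\Gamma\in C^3(\mathbb R^d;\mathbb R)$ be even with $$C_\Gamma:=\max\{\|D\Gamma\|_\infty,\|D^2\Gamma\|_\infty,\|D^3\Gamma\|_\infty\}<\infty .$$ The Hamiltonian Vlasov equation is $$\partial_t\alpha=\Big[\tfrac{|v|^2}{2}+\Gamma*|\alpha(t)|^2,\ \alpha(t)\Big]-\big(\Gamma*[\bar\alpha(t),\alpha(t)]\big)\,\alpha(t),\qquad (\mathrm{HVl})$$ where $[f,g]=\nabla_xf\cdot\nabla_vg-\nabla_vf\cdot\nabla_xg$ and $(\Gamma*f)(x)=\int\Gamma(x-y)f(y,w)\,d(y,w)$. A classical solution is a function $\alpha\in C^1([0,\infty)\times\mathbb R^{2d};\mathbb C)$ with support in $z$ contained in a compact set that is uniform on bounded time intervals, which satisfies (HVl) pointwise.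 A solution with initial value $\alpha_0\in W^{1,2}$ is a map $t\mapsto\alpha(t)\in L^2$, $t\ge 0$, with $\alpha(0)=\alpha_0$, that is a limit in $L^2$, uniformly on bounded time intervals, of classical solutions whose initial values converge to $\alpha_0$ in $W^{1,2}$. 1. Let $\alpha$ be a solution of (HVl) with $\|\alpha(0)\|_{W^{1,2}}\le M$. Then for all $t\ge0$, $\alpha(t)\in W^{1,2}$ and $$\|\alpha(t)\|_{W^{1,2}}\le R_M(t):=M\,\frac{1+C_\Gamma M^2+(1+3C_\Gamma M^2)\,e^{(1+2C_\Gamma M^2)t}}{1+2C_\Gamma M^2}.$$ (The function $R_M$ is the solution of $R_M(t)=M(1+e^{(1+C_\Gamma M^2)t})+C_\Gamma M^2\int_0^tR_M(\tau)e^{(1+C_\Gamma M^2)(t-\tau)}\,d\tau$.) 2. Let $M>0$ and $\alpha_0,\beta_0\in W^{1,2}$ with $\|\alpha_0\|_{W^{1,2}},\|\beta_0\|_{W^{1,2}}\le M$, and let $\alpha,\beta$ be solutions of (HVl) with initial values $\alpha_0,\beta_0$. Then for all $t\ge0$ $$\|\alpha(t)-\beta(t)\|\le\|\alpha_0-\beta_0\|\,\exp\Big(\int_0^t\big(1+4C_\Gamma^2M^2Q_M(\tau)^2\big)\,d\tau\Big),\qquad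 Q_M(t):=M\,\frac{1+C_\Gamma M^2+C_\Gamma M^2e^{(1+2C_\Gamma M^2)t}}{1+2C_\Gamma M^2}.$$ Since $Q_M\le R_M$, the same estimate holds with $R_M$ in place of $Q_M$. -/

import Mathlib

open MeasureTheory Filter Topology Set
open scoped ContDiff ComplexConjugate

noncomputable section

namespace HamiltonVlasov

/-- Physical space `ℝ^d` (positions or velocities), with its Euclidean norm. -/
abbrev Space (d : ℕ) := EuclideanSpace ℝ (Fin d)

/-- One-particle phase space; a point is `z = (x, v)`, and `volume` is Lebesgue measure. -/
abbrev PhaseSpace (d : ℕ) := Space d × Space d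

/-- The complex Hilbert space `L²(ℝ^d × ℝ^d)`. -/
abbrev L2 (d : ℕ) := Lp ℂ 2 (volume : Measure (PhaseSpace d))

/-- The `i`-th unit vector in the position variable. -/
def dirX {d : ℕ} (i : Fin d) : PhaseSpace d := (EuclideanSpace.single i 1, 0)

/-- The `i`-th unit vector in the velocity variable. -/
def dirV {d : ℕ} (i : Fin d) : PhaseSpace d := (0, EuclideanSpace.single i 1)

/-! The interaction potential -/

/-- Standing assumptions on the potential: `Γ` is even, of class `C³`, and its first, second and
third derivatives are bounded (`Γ` itself need not be bounded). -/
structure RegularPotential {d : ℕ} (Γ : Space d → ℝ) : Prop where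
  even : ∀ x, Γ (-x) = Γ x
  contDiff : ContDiff ℝ 3 Γ
  bddAbove : ∀ k ∈ Finset.Icc 1 3, BddAbove (range fun x => ‖iteratedFDeriv ℝ k Γ x‖)

/-- `C_Γ`, the largest of the three numbers `sup_x |D^k Γ(x)|`, `k = 1, 2, 3`, with the operator
norm of the `k`-linear form `D^k Γ(x)`. -/
def potConst {d : ℕ} (Γ : Space d → ℝ) : ℝ :=
  max (⨆ x, ‖iteratedFDeriv ℝ 1 Γ x‖)
    (max (⨆ x, ‖iteratedFDeriv ℝ 2 Γ x‖) (⨆ x, ‖iteratedFDeriv ℝ 3 Γ x‖))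

/-! The Sobolev space `W^{1,2}` of phase space -/

/-- `g` is the weak derivative of `u` in the direction `w`. -/
def IsWeakDeriv {d : ℕ} (w : PhaseSpace d) (u g : L2 d) : Prop :=
  ∀ φ : PhaseSpace d → ℝ, ContDiff ℝ ∞ φ → HasCompactSupport φ →
    ∫ z, (fderiv ℝ φ z w) • u z = - ∫ z, φ z • g z

/-- `u ∈ W^{1,2}`: all first order weak partial derivatives exist in `L²`. -/
def MemW12 {d : ℕ} (u : L2 d) : Prop :=
  ∀ i : Fin d, (∃ g, IsWeakDeriv (dirX i) u g) ∧ (∃ g, IsWeakDeriv (dirV i) u g)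

open Classical in
/-- The weak derivative of `u` in the direction `w` (zero if there is none in `L²`). -/
def weakDeriv {d : ℕ} (w : PhaseSpace d) (u : L2 d) : L2 d :=
  if h : ∃ g, IsWeakDeriv w u g then h.choose else 0

/-- The `W^{1,2}` norm `(‖u‖² + ‖∇_x u‖² + ‖∇_v u‖²)^{1/2}` of `u ∈ W^{1,2}`. -/
def w12Norm {d : ℕ} (u : L2 d) : ℝ :=
  Real.sqrt (‖u‖ ^ 2 + ∑ i, ‖weakDeriv (dirX i) u‖ ^ 2 + ∑ i, ‖weakDeriv (dirV i) u‖ ^ 2)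

/-! The Hamiltonian Vlasov equation -/

/-- Poisson bracket `[f, g] = ∇_x f · ∇_v g - ∇_v f · ∇_x g` (no complex conjugation). -/
def poisson {d : ℕ} (f g : PhaseSpace d → ℂ) (z : PhaseSpace d) : ℂ :=
  ∑ i, (fderiv ℝ f z (dirX i) * fderiv ℝ g z (dirV i)
    - fderiv ℝ f z (dirV i) * fderiv ℝ g z (dirX i))

/-- `(Γ * f)(x) = ∫ Γ(x - y) f(y, w) d(y, w)` for a function `f` on phase space. -/
def conv {d : ℕ} (Γ : Space d → ℝ) (f : PhaseSpace d → ℂ) (x : Space d) : ℂ :=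
  ∫ z : PhaseSpace d, Γ (x - z.1) • f z

/-- The mean field Hamiltonian `|v|²/2 + (Γ * |a|²)(x)`. -/
def meanFieldHamiltonian {d : ℕ} (Γ : Space d → ℝ) (a : PhaseSpace d → ℂ) (z : PhaseSpace d) : ℂ :=
  ((‖z.2‖ ^ 2 / 2 : ℝ) : ℂ) + conv Γ (fun y => ((‖a y‖ ^ 2 : ℝ) : ℂ)) z.1

/-- The right hand side `[|v|²/2 + Γ * |a|², a] - (Γ * [ā, a]) a` of the Hamiltonian Vlasov
equation. -/
def hvlRhs {d : ℕ} (Γ : Space d → ℝ) (a : PhaseSpace d → ℂ) (z : PhaseSpace d) : ℂ :=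
  poisson (meanFieldHamiltonian Γ a) a z - conv Γ (poisson (fun y => conj (a y)) a) z.1 * a z

/-- `u` is (the curve in `L²` of) a classical solution on `[0, ∞)` with compact support: it is
represented by a function `a` that is `C¹` in `(t, z)`, is compactly supported in `z`, uniformly on
bounded time intervals, and satisfies the Hamiltonian Vlasov equation at every point. -/
def IsClassicalSolution {d : ℕ} (Γ : Space d → ℝ) (u : ℝ → L2 d) : Prop :=
  ∃ a : ℝ → PhaseSpace d → ℂ,
    (∀ t, 0 ≤ t → u t =ᵐ[volume] a t) ∧
    ContDiffOn ℝ 1 (fun p : ℝ × PhaseSpace d => a p.1 p.2) (Ici 0 ×ˢ univ) ∧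
    (∀ T : ℝ, ∃ K : Set (PhaseSpace d), IsCompact K ∧ ∀ t ∈ Icc 0 T, ∀ z, z ∉ K → a t z = 0) ∧
    ∀ t, 0 ≤ t → ∀ z, HasDerivWithinAt (fun s => a s z) (hvlRhs Γ (a t) z) (Ici 0) t

/-- `α` is a global solution of the Hamiltonian Vlasov equation with initial value
`α 0 ∈ W^{1,2}`: a limit in `L²`, uniform on bounded time intervals, of compactly supported
classical solutions whose initial values converge to `α 0` in `W^{1,2}` (that is, the value at
`α 0` of the extension of the classical solution map to `W^{1,2}`). -/
def IsSolution {d : ℕ} (Γ : Space d → ℝ) (α : ℝ → L2 d) : Prop :=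
  MemW12 (α 0) ∧
  ∃ u : ℕ → ℝ → L2 d,
    (∀ n, IsClassicalSolution Γ (u n)) ∧
    Tendsto (fun n => w12Norm (u n 0 - α 0)) atTop (𝓝 0) ∧
    ∀ T : ℝ, TendstoUniformlyOn u α atTop (Icc 0 T)

/-! The two explicit functions of time, for `C = C_Γ` -/

/-- `M (1 + C M² + C M² e^{(1 + 2 C M²) t}) / (1 + 2 C M²)`. -/
def boundQ (C M t : ℝ) : ℝ :=
  M * (1 + C * M ^ 2 + C * M ^ 2 * Real.exp ((1 + 2 * C * M ^ 2) * t)) / (1 + 2 * C * M ^ 2)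

/-- `M (1 + C M² + (1 + 3 C M²) e^{(1 + 2 C M²) t}) / (1 + 2 C M²)`, the fixed point of
`R(t) = M (1 + e^{(1 + C M²) t}) + C M² ∫_0^t R(τ) e^{(1 + C M²)(t - τ)} dτ`. -/
def boundR (C M t : ℝ) : ℝ :=
  M * (1 + C * M ^ 2 + (1 + 3 * C * M ^ 2) * Real.exp ((1 + 2 * C * M ^ 2) * t)) /
    (1 + 2 * C * M ^ 2)

end HamiltonVlasov

end

namespace HamiltonVlasov

/-! ### Line derivatives and their averages -/

section LineDeriv

variable {E V : Type*} [NormedAddCommGroup E] [NormedSpace ℝ E] [NormedAddCommGroup V]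
  [NormedSpace ℝ V]

/-! Everything is proved for classical solutions and passed to the limit. For these, (HVl) is a
transport equation `∂ₜa = ∑ Bₖ ∂ₖa − Φ a` (`hvlRhs_eq`). Each `Bₖ` is independent of its own
coordinate, so the field is divergence free. Since `[ā, a]` is minus its own conjugate, `Φ` is
purely imaginary. Such an operator is skew-adjoint, so only source terms change an `L²` norm
(`integral_normSq_sub_eq_source`); in particular the mass `m` is conserved.

Differentiating the equation in the coordinate directions leaves commutator sources. Free streaming
contributes the rate 1, while the mean field and the phase contribute `C m` each, so `‖∇a‖²` grows
at most like `exp((1 + 2 C m) t)` (`IsFlow.gradSq_le`). Hence the Sobolev norm is at most `N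
exp((1/2 + C N²) t)`, with `N` its initial value; this lies below `R_M` whenever `N ≤ M`.

For two solutions the equation is split symmetrically: the averaged operator acts on the difference
and is again skew-adjoint, and the difference of the operators acts on the average of the solutions
(`IsFlow.massSq_sub_le`). Every bracket is integrated by parts against `Γ` (`conv_poisson`), so no
derivative falls on the difference and only velocity gradients remain. The resulting rate is `2 C M²
exp((1/2 + C M²) t)`, and an elementary inequality (`rate_le`) puts it below the stated integrand.

Classical solutions are only `C¹`, so the differentiated equation and the mixed second derivatives
are not available pointwise. Both are replaced by identities for difference quotients, written as
segment averages of the first derivative; these are continuous in the step down to step zero.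

In the limit, the Sobolev bound survives by weak compactness (`memW12_of_tendsto`), and the
stability bound by continuity of both sides. -/

theorem lineDeriv_eq_zero_of_notMem {f : E → V} {f' : V} {w z : E} {K : Set E} (hK : IsClosed K)
    (h0 : ∀ y, y ∉ K → f y = 0) (hz : z ∉ K) (hd : HasLineDerivAt ℝ f f' z w) : f' = 0 := by
  have h1 : (fun _ : E => (0 : V)) =ᶠ[𝓝 z] f := by
    filter_upwards [hK.isOpen_compl.mem_nhds hz] with y hy using (h0 y hy).symm
  have h2 : HasLineDerivAt ℝ (fun _ : E => (0 : V)) f' z w := hd.congr_of_eventuallyEq h1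
  refine h2.unique ?_
  simpa using (hasFDerivAt_const (0 : V) z).hasLineDerivAt (𝕜 := ℝ) w

theorem HasLineDerivAt.hasDerivAt_line {f : E → V} {f' : E → V} {w : E}
    (hd : ∀ z, HasLineDerivAt ℝ f (f' z) z w) (z : E) (s : ℝ) :
    HasDerivAt (fun r : ℝ => f (z + r • w)) (f' (z + s • w)) s := by
  have h := hd (z + s • w)
  unfold HasLineDerivAt at h
  have h2 : HasDerivAt (fun r : ℝ => r - s) 1 s := (hasDerivAt_id s).sub_const s
  have h3 := HasDerivAt.scomp_of_eq s h h2 (by simp)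
  refine (h3.congr_of_eventuallyEq ?_).congr_deriv (by simp)
  filter_upwards with r
  simp only [Function.comp, sub_smul]
  congr 1
  abel

theorem HasLineDerivAt.comp_add_right {f : E → V} {f' : E → V} {w : E}
    (hd : ∀ z, HasLineDerivAt ℝ f (f' z) z w) (y z : E) :
    HasLineDerivAt ℝ (fun x => f (x + y)) (f' (z + y)) z w := by
  have h := hd (z + y)
  unfold HasLineDerivAt at h ⊢
  refine h.congr_of_eventuallyEq ?_
  filter_upwards with r
  congr 1
  abel

theorem HasLineDerivAt.mul' {A : Type*} [NormedRing A] [NormedAlgebra ℝ A] {f g : E → A} {f' g' : A}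
    {w z : E} (hf : HasLineDerivAt ℝ f f' z w) (hg : HasLineDerivAt ℝ g g' z w) :
    HasLineDerivAt ℝ (fun x => f x * g x) (f' * g z + f z * g') z w := by
  unfold HasLineDerivAt at hf hg ⊢
  have h := HasDerivAt.mul hf hg
  simp only [zero_smul, add_zero] at h
  exact h

theorem HasLineDerivAt.sub' {f g : E → V} {f' g' : V}
    {w z : E} (hf : HasLineDerivAt ℝ f f' z w) (hg : HasLineDerivAt ℝ g g' z w) :
    HasLineDerivAt ℝ (fun x => f x - g x) (f' - g') z w := by
  unfold HasLineDerivAt at hf hg ⊢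
  exact HasDerivAt.sub hf hg

theorem HasLineDerivAt.const_smul' {f : E → V} {f' : V}
    {w z : E} (c : ℝ) (hf : HasLineDerivAt ℝ f f' z w) :
    HasLineDerivAt ℝ (fun x => c • f x) (c • f') z w := by
  unfold HasLineDerivAt at hf ⊢
  exact HasDerivAt.const_smul c hf

theorem HasLineDerivAt.ofReal {f : E → ℝ} {f' : ℝ} {w z : E} (hf : HasLineDerivAt ℝ f f' z w) :
    HasLineDerivAt ℝ (fun x => (f x : ℂ)) (f' : ℂ) z w := by
  unfold HasLineDerivAt at hf ⊢
  exact HasDerivAt.ofReal_comp hf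

theorem HasLineDerivAt.conj {f : E → ℂ} {f' : ℂ} {w z : E} (hf : HasLineDerivAt ℝ f f' z w) :
    HasLineDerivAt ℝ (fun x => conj (f x)) (conj f') z w := by
  unfold HasLineDerivAt at hf ⊢
  exact HasDerivAt.star hf

theorem HasLineDerivAt.normSq {f : E → ℂ} {f' : ℂ} {w z : E} (hf : HasLineDerivAt ℝ f f' z w) :
    HasLineDerivAt ℝ (fun x => ‖f x‖ ^ 2) (2 * (conj (f z) * f').re) z w := by
  unfold HasLineDerivAt at hf ⊢
  have h := HasDerivAt.norm_sq hf
  convert! h using 1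
  simp [Complex.inner]
  ring

variable (w : E)

/-- The mean value of `f` over the segment from `z` to `z + h • w`. -/
noncomputable def segmentAverage (f : E → V) (h : ℝ) (z : E) : V :=
  ∫ s in (0 : ℝ)..1, f (z + (s * h) • w)

@[simp] theorem segmentAverage_zero [CompleteSpace V] (f : E → V) (z : E) : segmentAverage w f 0 z = f z := by
  simp [segmentAverage]

variable {w}

theorem smul_segmentAverage [CompleteSpace V] {f f' : E → V} (hf' : Continuous f')
    (hd : ∀ z, HasLineDerivAt ℝ f (f' z) z w) (h : ℝ) (z : E) :
    h • segmentAverage w f' h z = f (z + h • w) - f z := by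
  have h1 : ∀ s ∈ uIcc (0 : ℝ) 1, HasDerivAt (fun s : ℝ => f (z + (s * h) • w))
      (h • f' (z + (s * h) • w)) s := fun s _ => by
    have h2 : HasDerivAt (fun s : ℝ => s * h) h s := by
      simpa using (hasDerivAt_id s).mul_const h
    exact HasDerivAt.scomp s (HasLineDerivAt.hasDerivAt_line hd z (s * h)) h2
  have h3 := intervalIntegral.integral_eq_sub_of_hasDerivAt h1
    (Continuous.intervalIntegrable (by fun_prop) _ _)
  rw [segmentAverage, ← intervalIntegral.integral_smul, h3]
  simp

/-- For nonzero step the average of the derivative is a difference quotient, and for step zero it is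
the derivative itself. The averaged form makes the quotient jointly continuous in step and point,
using only continuity of `f'`. -/
theorem segmentAverage_eq [CompleteSpace V] {f f' : E → V} (hf' : Continuous f')
    (hd : ∀ z, HasLineDerivAt ℝ f (f' z) z w) {h : ℝ} (hh : h ≠ 0) (z : E) :
    segmentAverage w f' h z = h⁻¹ • (f (z + h • w) - f z) := by
  rw [← smul_segmentAverage hf' hd, smul_smul, inv_mul_cancel₀ hh, one_smul]

theorem continuous_segmentAverage {X : Type*} [TopologicalSpace X] [FirstCountableTopology X]
    {f : X → E → V}
    (hf : Continuous (fun p : X × E => f p.1 p.2)) :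
    Continuous (fun p : X × ℝ × E => segmentAverage w (f p.1) p.2.1 p.2.2) := by
  unfold segmentAverage
  refine intervalIntegral.continuous_parametric_intervalIntegral_of_continuous'
    (f := fun (p : X × ℝ × E) (s : ℝ) => f p.1 (p.2.2 + (s * p.2.1) • w)) ?_ 0 1
  exact hf.comp (f := fun q : (X × ℝ × E) × ℝ => (q.1.1, q.1.2.2 + (q.2 * q.1.2.1) • w))
    (by fun_prop)

omit [NormedSpace ℝ V] in
-- The device for letting the step of a difference quotient tend to zero: an identity proved for
-- steps in `(0, 1]` extends to step zero by continuity.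
theorem eq_at_zero_of_eqOn_Ioc {f g : ℝ → V} (hf : Continuous f) (hg : Continuous g)
    (h : ∀ x ∈ Ioc (0 : ℝ) 1, f x = g x) : f 0 = g 0 := by
  have h1 : Tendsto f (𝓝[>] 0) (𝓝 (f 0)) := (hf.tendsto 0).mono_left nhdsWithin_le_nhds
  have h2 : Tendsto g (𝓝[>] 0) (𝓝 (g 0)) := (hg.tendsto 0).mono_left nhdsWithin_le_nhds
  refine tendsto_nhds_unique (h1.congr' ?_) h2
  filter_upwards [Ioc_mem_nhdsGT (zero_lt_one (α := ℝ))] with x hx using h x hx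

end LineDeriv

/-! ### Integration by parts -/

section Integral

variable {E V : Type*} [NormedAddCommGroup E] [NormedSpace ℝ E] [FiniteDimensional ℝ E]
  [MeasurableSpace E] [BorelSpace E] {μ : Measure E} [μ.IsAddHaarMeasure]
  [NormedAddCommGroup V] [NormedSpace ℝ V]

omit [NormedSpace ℝ E] [FiniteDimensional ℝ E] [NormedSpace ℝ V] [μ.IsAddHaarMeasure] in
theorem integrable_of_eq_zero_off [IsFiniteMeasureOnCompacts μ] {F : E → V} {K : Set E} (hF : Continuous F) (hK : IsCompact K)
    (h0 : ∀ z, z ∉ K → F z = 0) : Integrable F μ :=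
  hF.integrable_of_hasCompactSupport (HasCompactSupport.intro hK h0)

/-- Integration by parts against the constant function 1. -/
theorem integral_lineDeriv_eq_zero {F F' : E → ℂ} {w : E} {K : Set E} (hF : Continuous F)
    (hF' : Continuous F') (hK : IsCompact K) (h0 : ∀ z, z ∉ K → F z = 0)
    (hd : ∀ z, HasLineDerivAt ℝ F (F' z) z w) : ∫ z, F' z ∂μ = 0 := by
  have h0' : ∀ z, z ∉ K → F' z = 0 := fun z hz =>
    lineDeriv_eq_zero_of_notMem hK.isClosed h0 hz (hd z)
  have hi := integrable_of_eq_zero_off (μ := μ) hF' hK h0'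
  have h1 := integral_bilinear_hasLineDerivAt_right_eq_neg_left_of_integrable (μ := μ)
    (B := ContinuousLinearMap.mul ℝ ℂ) (f := fun _ : E => (1 : ℂ)) (f' := fun _ => 0)
    (g := F) (g' := F') (v := w) (by simp) (by simpa using hi)
    (by simpa using integrable_of_eq_zero_off (μ := μ) hF hK h0)
    (fun x _ => by simpa using (hasFDerivAt_const (1 : ℂ) x).hasLineDerivAt (𝕜 := ℝ) w)
    (fun x _ => hd x)
  simpa using h1

omit [NormedAddCommGroup E] [NormedSpace ℝ E] [FiniteDimensional ℝ E] [BorelSpace E]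
  [μ.IsAddHaarMeasure] in
theorem setIntegral_eq_integral_of_eq_zero_off {F : E → V} {K : Set E}
    (h0 : ∀ z, z ∉ K → F z = 0) : ∫ z in K, F z ∂μ = ∫ z, F z ∂μ :=
  setIntegral_eq_integral_of_forall_compl_eq_zero h0

omit [FiniteDimensional ℝ E] [MeasurableSpace E] [BorelSpace E] in
-- One compact set serves all shifts of size at most 1, so integrals of difference quotients live on
-- a domain that does not depend on the step.
theorem exists_compact_segments {K : Set E} [FiniteDimensional ℝ E] (hK : IsCompact K) (w : E) :
    ∃ K' : Set E, IsCompact K' ∧ K ⊆ K' ∧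
      ∀ z, z ∉ K' → ∀ h ∈ Icc (-1 : ℝ) 1, z + h • w ∉ K := by
  refine ⟨(fun p : E × ℝ => p.1 - p.2 • w) '' (K ×ˢ Icc (-1 : ℝ) 1),
    (hK.prod isCompact_Icc).image (by fun_prop), fun z hz => ⟨(z, 0), by simp [hz], by simp⟩, ?_⟩
  intro z hz h hh hc
  exact hz ⟨(z + h • w, h), ⟨hc, hh⟩, by simp⟩

omit [FiniteDimensional ℝ E] [MeasurableSpace E] [BorelSpace E] in
theorem segmentAverage_eq_zero {f : E → V} {K K' : Set E} {w : E} (h0 : ∀ z, z ∉ K → f z = 0)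
    (hK' : ∀ z, z ∉ K' → ∀ h ∈ Icc (-1 : ℝ) 1, z + h • w ∉ K) {h : ℝ} (hh : h ∈ Icc (-1 : ℝ) 1)
    {z : E} (hz : z ∉ K') : segmentAverage w f h z = 0 := by
  unfold segmentAverage
  rw [intervalIntegral.integral_congr (g := fun _ => (0 : V))]
  · simp
  · intro s hs
    rw [uIcc_of_le zero_le_one] at hs
    refine h0 _ (hK' z hz _ ⟨?_, ?_⟩)
    · nlinarith [hs.1, hs.2, hh.1, hh.2]
    · nlinarith [hs.1, hs.2, hh.1, hh.2]

/-- Mixed second order derivatives commute under the integral, for functions that are only `C¹`. -/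
theorem integral_lineDeriv_mul_comm {f g fu fw gu gw : E → ℂ} {u w : E} {K : Set E}
    (hf : Continuous f) (hg : Continuous g) (hfu : Continuous fu) (hfw : Continuous fw)
    (hgu : Continuous gu) (hgw : Continuous gw) (hK : IsCompact K) (h0 : ∀ z, z ∉ K → f z = 0)
    (dfu : ∀ z, HasLineDerivAt ℝ f (fu z) z u) (dfw : ∀ z, HasLineDerivAt ℝ f (fw z) z w)
    (dgu : ∀ z, HasLineDerivAt ℝ g (gu z) z u) (dgw : ∀ z, HasLineDerivAt ℝ g (gw z) z w) :
    ∫ z, fw z * gu z ∂μ = ∫ z, fu z * gw z ∂μ := by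
  obtain ⟨K', hK', hKK', hseg⟩ := exists_compact_segments hK u
  have h0u : ∀ z, z ∉ K → fu z = 0 := fun z hz =>
    lineDeriv_eq_zero_of_notMem hK.isClosed h0 hz (dfu z)
  have h0w : ∀ z, z ∉ K → fw z = 0 := fun z hz =>
    lineDeriv_eq_zero_of_notMem hK.isClosed h0 hz (dfw z)
  have hcont : ∀ φ : E → ℂ, Continuous φ →
      Continuous (fun p : ℝ × E => segmentAverage u φ p.1 p.2) := fun φ hφ =>
    (continuous_segmentAverage (X := Unit) (w := u) (f := fun _ => φ) (by fun_prop)).comp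
      (f := fun p : ℝ × E => ((), p)) (by fun_prop)
  have hgu' := hcont gu hgu
  have hfu' := hcont fu hfu
  -- For a positive step, `gu` becomes a difference quotient of `g` along `u`, which is still `C¹`
  -- along `w`. Integrating by parts along `w` puts `gw` inside the quotient, and translation
  -- invariance moves the quotient onto `f`, with the opposite step `-h`. No second derivative
  -- appears.
  have key := eq_at_zero_of_eqOn_Ioc
    (f := fun h => ∫ z in K', fw z * segmentAverage u gu h z ∂μ)
    (g := fun h => ∫ z in K', segmentAverage u fu (-h) z * gw z ∂μ)
    (continuous_parametric_integral_of_continuous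
      (f := fun h z => fw z * segmentAverage u gu h z) (by fun_prop) hK')
    (continuous_parametric_integral_of_continuous
      (f := fun h z => segmentAverage u fu (-h) z * gw z)
      (by
        have : Continuous (fun p : ℝ × E => segmentAverage u fu (-p.1) p.2) :=
          hfu'.comp (f := fun p : ℝ × E => (-p.1, p.2)) (by fun_prop)
        fun_prop) hK')
    (fun h hh => by
      have hne : h ≠ 0 := hh.1.ne'
      rw [setIntegral_eq_integral_of_eq_zero_off (fun z hz => by
          rw [h0w z (fun hc => hz (hKK' hc)), zero_mul]),
        setIntegral_eq_integral_of_eq_zero_off (fun z hz => by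
          rw [segmentAverage_eq_zero h0u hseg ⟨by linarith [hh.2], by linarith [hh.1]⟩ hz,
            zero_mul])]
      simp only [segmentAverage_eq hgu dgu hne, segmentAverage_eq hfu dfu (neg_ne_zero.2 hne)]
      have ibp := integral_lineDeriv_eq_zero (μ := μ) (w := w) (K := K)
        (F := fun z => f z * (h⁻¹ • (g (z + h • u) - g z)))
        (F' := fun z => fw z * (h⁻¹ • (g (z + h • u) - g z)) +
          f z * (h⁻¹ • (gw (z + h • u) - gw z)))
        (by fun_prop) (by fun_prop) hK (fun z hz => by simp [h0 z hz])
        (fun z => HasLineDerivAt.mul' (dfw z) (HasLineDerivAt.const_smul' _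
          (HasLineDerivAt.sub' (HasLineDerivAt.comp_add_right dgw _ z) (dgw z))))
      have i1 : Integrable (fun z => fw z * (h⁻¹ • (g (z + h • u) - g z))) μ :=
        integrable_of_eq_zero_off (by fun_prop) hK (fun z hz => by simp [h0w z hz])
      have i2 : Integrable (fun z => f z * (h⁻¹ • (gw (z + h • u) - gw z))) μ :=
        integrable_of_eq_zero_off (by fun_prop) hK (fun z hz => by simp [h0 z hz])
      rw [integral_add i1 i2] at ibp
      rw [eq_neg_of_add_eq_zero_left ibp]
      have i3 : Integrable (fun z => f z * gw (z + h • u)) μ :=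
        integrable_of_eq_zero_off (by fun_prop) hK (fun z hz => by simp [h0 z hz])
      have i4 : Integrable (fun z => f z * gw z) μ :=
        integrable_of_eq_zero_off (by fun_prop) hK (fun z hz => by simp [h0 z hz])
      have i5 : Integrable (fun z => f (z + (-h) • u) * gw z) μ :=
        integrable_of_eq_zero_off (by fun_prop) hK' (fun z hz => by
          rw [h0 _ (hseg z hz (-h) ⟨by linarith [hh.2], by linarith [hh.1]⟩), zero_mul])
      have e1 : ∫ z, f z * (h⁻¹ • (gw (z + h • u) - gw z)) ∂μ
          = h⁻¹ • (∫ z, f z * gw (z + h • u) ∂μ - ∫ z, f z * gw z ∂μ) := by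
        rw [← integral_sub i3 i4, ← integral_smul]
        congr 1; ext z; simp only [Complex.real_smul]; ring
      have e2 : ∫ z, ((-h)⁻¹ • (f (z + (-h) • u) - f z)) * gw z ∂μ
          = (-h)⁻¹ • (∫ z, f (z + (-h) • u) * gw z ∂μ - ∫ z, f z * gw z ∂μ) := by
        rw [← integral_sub i5 i4, ← integral_smul]
        congr 1; ext z; simp only [Complex.real_smul]; ring
      have e3 : ∫ z, f (z + (-h) • u) * gw z ∂μ = ∫ z, f z * gw (z + h • u) ∂μ := by
        rw [← integral_add_right_eq_self _ (h • u)]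
        congr 1; ext z; congr 2; simp
      rw [e1, e2, e3, inv_neg, neg_smul])
  simp only [neg_zero, segmentAverage_zero] at key
  rwa [setIntegral_eq_integral_of_eq_zero_off (fun z hz => by
      rw [h0w z (fun hc => hz (hKK' hc)), zero_mul]),
    setIntegral_eq_integral_of_eq_zero_off (fun z hz => by
      rw [h0u z (fun hc => hz (hKK' hc)), zero_mul])] at key

end Integral

end HamiltonVlasov

namespace HamiltonVlasov

/-! ### Energy identities for transport equations -/

section Energy

variable {E : Type*} [NormedAddCommGroup E] [NormedSpace ℝ E] [FiniteDimensional ℝ E]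
  [MeasurableSpace E] [BorelSpace E] {μ : Measure E} [μ.IsAddHaarMeasure]

/-- The derivative in time of the square of the `L²` norm, in integrated form. -/
theorem integral_normSq_sub_eq {F G : ℝ → E → ℂ} (hF : Continuous (fun p : ℝ × E => F p.1 p.2))
    (hG : Continuous (fun p : ℝ × E => G p.1 p.2)) {T : ℝ} (hT : 0 ≤ T)
    (hd : ∀ t ∈ Ioo 0 T, ∀ z, HasDerivWithinAt (fun s => F s z) (G t z) (Ioi t) t)
    {K : Set E} (hK : IsCompact K) (h0 : ∀ t ∈ Icc 0 T, ∀ z, z ∉ K → F t z = 0) :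
    ∫ z, ‖F T z‖ ^ 2 ∂μ - ∫ z, ‖F 0 z‖ ^ 2 ∂μ
      = ∫ t in (0 : ℝ)..T, ∫ z, 2 * (conj (F t z) * G t z).re ∂μ := by
  have hc : Continuous (fun p : ℝ × E => 2 * (conj (F p.1 p.2) * G p.1 p.2).re) := by
    fun_prop
  have hFT : Continuous (F T) := hF.comp (f := fun z => (T, z)) (by fun_prop)
  have hF0 : Continuous (F 0) := hF.comp (f := fun z => ((0 : ℝ), z)) (by fun_prop)
  have e1 : ∀ t ∈ Icc 0 T, ∀ z, z ∉ K → 2 * (conj (F t z) * G t z).re = 0 := fun t ht z hz => by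
    simp [h0 t ht z hz]
  have ftc : ∀ z, ∫ t in (0 : ℝ)..T, 2 * (conj (F t z) * G t z).re = ‖F T z‖ ^ 2 - ‖F 0 z‖ ^ 2 := by
    intro z
    refine intervalIntegral.integral_eq_sub_of_hasDeriv_right (f := fun t => ‖F t z‖ ^ 2) ?_ ?_ ?_
    · have : Continuous (fun t => F t z) := hF.comp (f := fun t => (t, z)) (by fun_prop)
      exact Continuous.continuousOn (by fun_prop)
    · intro t ht
      rw [min_eq_left hT, max_eq_right hT] at ht
      have h := (hd t ht z).norm_sq
      convert! h using 1
      simp [Complex.inner]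
      ring
    · exact (hc.comp (f := fun t => (t, z)) (by fun_prop)).intervalIntegrable _ _
  -- The fundamental theorem of calculus holds at each point; Fubini on the compact set `[0, T] × K`
  -- turns it into a statement about the integrals.
  have swap : ∫ t in (0 : ℝ)..T, ∫ z in K, 2 * (conj (F t z) * G t z).re ∂μ
      = ∫ z in K, (∫ t in (0 : ℝ)..T, 2 * (conj (F t z) * G t z).re) ∂μ := by
    refine intervalIntegral_integral_swap ?_
    rw [Measure.prod_restrict]
    have := (hc.continuousOn (s := Icc 0 T ×ˢ K)).integrableOn_compact
      (μ := volume.prod μ) (isCompact_Icc.prod hK)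
    refine this.mono_set (prod_mono ?_ subset_rfl)
    rw [uIoc_of_le hT]
    exact Ioc_subset_Icc_self
  have e2 : ∫ t in (0 : ℝ)..T, ∫ z, 2 * (conj (F t z) * G t z).re ∂μ
      = ∫ t in (0 : ℝ)..T, ∫ z in K, 2 * (conj (F t z) * G t z).re ∂μ := by
    refine intervalIntegral.integral_congr fun t ht => ?_
    rw [uIcc_of_le hT] at ht
    exact (setIntegral_eq_integral_of_eq_zero_off (e1 t ht)).symm
  have z1 : ∀ t ∈ Icc 0 T, ∀ z, z ∉ K → ‖F t z‖ ^ 2 = 0 := fun t ht z hz => by simp [h0 t ht z hz]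
  have hT' : T ∈ Icc 0 T := ⟨hT, le_rfl⟩
  have h0' : (0 : ℝ) ∈ Icc 0 T := ⟨le_rfl, hT⟩
  rw [e2, swap]
  simp only [ftc]
  rw [setIntegral_eq_integral_of_eq_zero_off (fun z hz => by
      rw [z1 T hT' z hz, z1 0 h0' z hz, sub_zero]), integral_sub]
  · exact integrable_of_eq_zero_off (by fun_prop) hK (z1 T hT')
  · exact integrable_of_eq_zero_off (by fun_prop) hK (z1 0 h0')

variable {ι : Type*} [Fintype ι] {e : ι → E}

/-- A divergence free transport operator with an imaginary potential is skew-adjoint. -/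
theorem integral_re_conj_mul_transport_eq_zero {f : E → ℂ} {f' : ι → E → ℂ} {B : ι → E → ℝ}
    {Φ : E → ℂ} (hf : Continuous f) (hf' : ∀ k, Continuous (f' k))
    (df : ∀ k z, HasLineDerivAt ℝ f (f' k z) z (e k))
    (hB : ∀ k, Continuous (B k)) (dB : ∀ k z, HasLineDerivAt ℝ (B k) 0 z (e k))
    (hΦ : ∀ z, (Φ z).re = 0) {K : Set E} (hK : IsCompact K) (h0 : ∀ z, z ∉ K → f z = 0) :
    ∫ z, 2 * (conj (f z) * (∑ k, B k z * f' k z - Φ z * f z)).re ∂μ = 0 := by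
  have e1 : ∀ z, 2 * (conj (f z) * (∑ k, B k z * f' k z - Φ z * f z)).re
      = ∑ k, B k z * (2 * (conj (f z) * f' k z).re) := by
    intro z
    have h1 : (conj (f z) * (Φ z * f z)).re = 0 := by
      have : conj (f z) * (Φ z * f z) = ((Complex.normSq (f z) : ℝ) : ℂ) * Φ z := by
        rw [Complex.normSq_eq_conj_mul_self]; ring
      rw [this, Complex.re_ofReal_mul, hΦ, mul_zero]
    rw [mul_sub, Complex.sub_re, h1, sub_zero, Finset.mul_sum, Complex.re_sum, Finset.mul_sum]
    refine Finset.sum_congr rfl fun k _ => ?_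
    rw [mul_left_comm, Complex.re_ofReal_mul]
    ring
  simp only [e1]
  rw [integral_finsetSum]
  · refine Finset.sum_eq_zero fun k _ => ?_
    -- As `B k` is constant along `e k`, the `k`-th term is the full derivative of `B k * ‖f‖²`
    -- along `e k`. The potential term has already dropped out, being `‖f‖²` times the real part of
    -- `Φ`.
    have h := integral_lineDeriv_eq_zero (μ := μ) (w := e k) (K := K)
      (F := fun z => ((B k z * ‖f z‖ ^ 2 : ℝ) : ℂ))
      (F' := fun z => ((B k z * (2 * (conj (f z) * f' k z).re) : ℝ) : ℂ))
      (by fun_prop) (by fun_prop) hK (fun z hz => by simp [h0 z hz]) (fun z => by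
        have := HasLineDerivAt.mul' (dB k z) (HasLineDerivAt.normSq (df k z))
        simp only [zero_mul, zero_add] at this
        exact HasLineDerivAt.ofReal this)
    rw [integral_complex_ofReal] at h
    exact_mod_cast h
  · intro k _
    exact integrable_of_eq_zero_off (by fun_prop) hK (fun z hz => by simp [h0 z hz])

/-- The energy identity for a transport equation with a source. -/
theorem integral_normSq_sub_eq_source {F S : ℝ → E → ℂ} {F' : ι → ℝ → E → ℂ} {B : ι → ℝ → E → ℝ}
    {Φ : ℝ → E → ℂ} (hF : Continuous (fun p : ℝ × E => F p.1 p.2))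
    (hF' : ∀ k, Continuous (fun p : ℝ × E => F' k p.1 p.2))
    (dF : ∀ k t z, HasLineDerivAt ℝ (F t) (F' k t z) z (e k))
    (hB : ∀ k, Continuous (fun p : ℝ × E => B k p.1 p.2))
    (dB : ∀ k t z, HasLineDerivAt ℝ (B k t) 0 z (e k))
    (hΦ : Continuous (fun p : ℝ × E => Φ p.1 p.2)) (hΦ' : ∀ t z, (Φ t z).re = 0)
    (hS : Continuous (fun p : ℝ × E => S p.1 p.2)) {T : ℝ} (hT : 0 ≤ T)
    (hd : ∀ t ∈ Ioo 0 T, ∀ z, HasDerivWithinAt (fun s => F s z)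
      (∑ k, B k t z * F' k t z - Φ t z * F t z + S t z) (Ioi t) t)
    {K : Set E} (hK : IsCompact K) (h0 : ∀ t ∈ Icc 0 T, ∀ z, z ∉ K → F t z = 0) :
    ∫ z, ‖F T z‖ ^ 2 ∂μ - ∫ z, ‖F 0 z‖ ^ 2 ∂μ
      = ∫ t in (0 : ℝ)..T, ∫ z, 2 * (conj (F t z) * S t z).re ∂μ := by
  rw [integral_normSq_sub_eq hF (by fun_prop) hT hd hK h0]
  refine intervalIntegral.integral_congr fun t ht => ?_
  rw [uIcc_of_le hT] at ht
  have c : ∀ {g : ℝ → E → ℂ}, Continuous (fun p : ℝ × E => g p.1 p.2) → Continuous (g t) :=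
    fun hg => hg.comp (f := fun z => (t, z)) (by fun_prop)
  have cF := c hF
  have cS := c hS
  have cΦ := c hΦ
  have cF' := fun k => c (hF' k)
  have cB : ∀ k, Continuous (B k t) := fun k => (hB k).comp (f := fun z => (t, z)) (by fun_prop)
  have h := integral_re_conj_mul_transport_eq_zero (μ := μ) cF cF'
    (fun k z => dF k t z) cB (fun k z => dB k t z) (hΦ' t) hK (h0 t ht)
  have e1 : ∀ z, 2 * (conj (F t z) * (∑ k, B k t z * F' k t z - Φ t z * F t z + S t z)).re
      = 2 * (conj (F t z) * (∑ k, B k t z * F' k t z - Φ t z * F t z)).re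
        + 2 * (conj (F t z) * S t z).re := fun z => by
    rw [mul_add, Complex.add_re, mul_add]
  simp only [e1]
  rw [integral_add, h, zero_add]
  · exact integrable_of_eq_zero_off (by fun_prop) hK (fun z hz => by simp [h0 t ht z hz])
  · exact integrable_of_eq_zero_off (by fun_prop) hK (fun z hz => by simp [h0 t ht z hz])

/-- The energy identity for a line derivative of a solution of a transport equation. -/
theorem integral_normSq_lineDeriv_sub_eq {a : ℝ → E → ℂ} {a' : ι → ℝ → E → ℂ}
    {aw : ℝ → E → ℂ} {w : E} {B Bw : ι → ℝ → E → ℝ} {Φ Φw : ℝ → E → ℂ}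
    (ha : Continuous (fun p : ℝ × E => a p.1 p.2))
    (ha' : ∀ k, Continuous (fun p : ℝ × E => a' k p.1 p.2))
    (haw : Continuous (fun p : ℝ × E => aw p.1 p.2))
    (da : ∀ k t z, HasLineDerivAt ℝ (a t) (a' k t z) z (e k))
    (daw : ∀ t z, HasLineDerivAt ℝ (a t) (aw t z) z w)
    (hB : ∀ k, Continuous (fun p : ℝ × E => B k p.1 p.2))
    (hBw : ∀ k, Continuous (fun p : ℝ × E => Bw k p.1 p.2))
    (dB : ∀ k t z, HasLineDerivAt ℝ (B k t) 0 z (e k))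
    (dBw : ∀ k t z, HasLineDerivAt ℝ (B k t) (Bw k t z) z w)
    (hΦ : Continuous (fun p : ℝ × E => Φ p.1 p.2))
    (hΦw : Continuous (fun p : ℝ × E => Φw p.1 p.2))
    (hΦ' : ∀ t z, (Φ t z).re = 0)
    (dΦw : ∀ t z, HasLineDerivAt ℝ (Φ t) (Φw t z) z w) {T : ℝ} (hT : 0 ≤ T)
    (hd : ∀ t ∈ Ioo 0 T, ∀ z, HasDerivWithinAt (fun s => a s z)
      (∑ k, B k t z * a' k t z - Φ t z * a t z) (Ioi t) t)
    {K : Set E} (hK : IsCompact K) (h0 : ∀ t ∈ Icc 0 T, ∀ z, z ∉ K → a t z = 0) :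
    ∫ z, ‖aw T z‖ ^ 2 ∂μ - ∫ z, ‖aw 0 z‖ ^ 2 ∂μ
      = ∫ t in (0 : ℝ)..T, ∫ z, 2 * (conj (aw t z) *
          (∑ k, Bw k t z * a' k t z - Φw t z * a t z)).re ∂μ := by
  obtain ⟨K', hK', hKK', hseg⟩ := exists_compact_segments hK w
  have h0w : ∀ t ∈ Icc 0 T, ∀ z, z ∉ K → aw t z = 0 := fun t ht z hz =>
    lineDeriv_eq_zero_of_notMem hK.isClosed (h0 t ht) hz (daw t z)
  have comp_t : ∀ {V : Type} [TopologicalSpace V] {g : ℝ → E → V} (t : ℝ),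
      Continuous (fun p : ℝ × E => g p.1 p.2) → Continuous (g t) :=
    fun t hg => hg.comp (f := fun z => (t, z)) (by fun_prop)
  have cA := continuous_segmentAverage (w := w) haw
  have cP := continuous_segmentAverage (w := w) hΦw
  have cBw := fun k => continuous_segmentAverage (w := w) (hBw k)
  -- The source in the discrete Leibniz rule: the quotient of `B ∂a` is `B` times the quotient of
  -- `∂a`, plus the quotient of `B` times the shifted `∂a`. The first part is transport of the
  -- quotient of `a`, the second goes into `S`; likewise for `Φ a`.
  let S : ℝ → ℝ → E → ℂ := fun h t z =>
    ∑ k, ((segmentAverage w (Bw k t) h z : ℝ) : ℂ) * a' k t (z + h • w)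
      - segmentAverage w (Φw t) h z * a t (z + h • w)
  have hSc : Continuous (fun p : ℝ × ℝ × E => S p.1 p.2.1 p.2.2) := by
    have c1 : ∀ k, Continuous (fun p : ℝ × ℝ × E => segmentAverage w (Bw k p.2.1) p.1 p.2.2) :=
      fun k => (cBw k).comp (f := fun p : ℝ × ℝ × E => (p.2.1, p.1, p.2.2)) (by fun_prop)
    have c2 : Continuous (fun p : ℝ × ℝ × E => segmentAverage w (Φw p.2.1) p.1 p.2.2) :=
      cP.comp (f := fun p : ℝ × ℝ × E => (p.2.1, p.1, p.2.2)) (by fun_prop)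
    have c3 : ∀ k, Continuous (fun p : ℝ × ℝ × E => a' k p.2.1 (p.2.2 + p.1 • w)) :=
      fun k => (ha' k).comp (f := fun p : ℝ × ℝ × E => (p.2.1, p.2.2 + p.1 • w)) (by fun_prop)
    have c4 : Continuous (fun p : ℝ × ℝ × E => a p.2.1 (p.2.2 + p.1 • w)) :=
      ha.comp (f := fun p : ℝ × ℝ × E => (p.2.1, p.2.2 + p.1 • w)) (by fun_prop)
    simp only [S]
    fun_prop
  have hAc : Continuous (fun p : ℝ × ℝ × E => segmentAverage w (aw p.2.1) p.1 p.2.2) :=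
    cA.comp (f := fun p : ℝ × ℝ × E => (p.2.1, p.1, p.2.2)) (by fun_prop)
  have hT' : T ∈ Icc 0 T := ⟨hT, le_rfl⟩
  have h0' : (0 : ℝ) ∈ Icc 0 T := ⟨le_rfl, hT⟩
  have mem1 : ∀ {h : ℝ}, h ∈ Ioc (0 : ℝ) 1 → h ∈ Icc (-1 : ℝ) 1 := fun hh =>
    ⟨by linarith [hh.1], hh.2⟩
  -- The quotient of `a` solves an honest transport equation with source `S h`, so its energy
  -- identity holds for each positive step. Both sides are continuous in the step, and at step zero
  -- they give the identity for `aw`.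
  have key := eq_at_zero_of_eqOn_Ioc
    (f := fun h => ∫ z in K', ‖segmentAverage w (aw T) h z‖ ^ 2 ∂μ
      - ∫ z in K', ‖segmentAverage w (aw 0) h z‖ ^ 2 ∂μ)
    (g := fun h => ∫ t in (0 : ℝ)..T, ∫ z in K',
      2 * (conj (segmentAverage w (aw t) h z) * S h t z).re ∂μ)
    (by
      have cT : ∀ t, Continuous (fun p : ℝ × E => segmentAverage w (aw t) p.1 p.2) := fun t =>
        hAc.comp (f := fun p : ℝ × E => (p.1, t, p.2)) (by fun_prop)
      refine Continuous.sub ?_ ?_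
      · have := cT T
        exact continuous_parametric_integral_of_continuous
          (f := fun h z => ‖segmentAverage w (aw T) h z‖ ^ 2) (by fun_prop) hK'
      · have := cT 0
        exact continuous_parametric_integral_of_continuous
          (f := fun h z => ‖segmentAverage w (aw 0) h z‖ ^ 2) (by fun_prop) hK')
    (by
      refine intervalIntegral.continuous_parametric_intervalIntegral_of_continuous' ?_ 0 T
      refine continuous_parametric_integral_of_continuous (X := ℝ × ℝ)
        (f := fun p z => 2 * (conj (segmentAverage w (aw p.2) p.1 z) * S p.1 p.2 z).re) ?_ hK'
      have c1 : Continuous (fun p : (ℝ × ℝ) × E => segmentAverage w (aw p.1.2) p.1.1 p.2) :=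
        hAc.comp (f := fun p : (ℝ × ℝ) × E => (p.1.1, p.1.2, p.2)) (by fun_prop)
      have c2 : Continuous (fun p : (ℝ × ℝ) × E => S p.1.1 p.1.2 p.2) :=
        hSc.comp (f := fun p : (ℝ × ℝ) × E => (p.1.1, p.1.2, p.2)) (by fun_prop)
      fun_prop)
    (fun h hh => by
      have hne : h ≠ 0 := hh.1.ne'
      have hz : ∀ t ∈ Icc 0 T, ∀ z, z ∉ K' → segmentAverage w (aw t) h z = 0 := fun t ht z hz =>
        segmentAverage_eq_zero (h0w t ht) hseg (mem1 hh) hz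
      have eA : ∀ t z, segmentAverage w (aw t) h z = h⁻¹ • (a t (z + h • w) - a t z) := fun t z =>
        segmentAverage_eq (comp_t t haw) (daw t) hne z
      rw [setIntegral_eq_integral_of_eq_zero_off (fun z hz' => by simp [hz T hT' z hz']),
        setIntegral_eq_integral_of_eq_zero_off (fun z hz' => by simp [hz 0 h0' z hz'])]
      rw [integral_normSq_sub_eq_source (e := e) (B := B) (Φ := Φ) (S := S h)
        (F := fun t z => segmentAverage w (aw t) h z)
        (F' := fun k t z => h⁻¹ • (a' k t (z + h • w) - a' k t z)) ?_ ?_ ?_ hB dB hΦ hΦ' ?_ hT ?_ hK'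
        hz]
      · refine intervalIntegral.integral_congr fun t ht => ?_
        rw [uIcc_of_le hT] at ht
        exact (setIntegral_eq_integral_of_eq_zero_off (fun z hz' => by simp [hz t ht z hz'])).symm
      · exact hAc.comp (f := fun p : ℝ × E => (h, p.1, p.2)) (by fun_prop)
      · intro k
        have c3 : Continuous (fun p : ℝ × E => a' k p.1 (p.2 + h • w)) :=
          (ha' k).comp (f := fun p : ℝ × E => (p.1, p.2 + h • w)) (by fun_prop)
        have := ha' k
        fun_prop
      · intro k t z
        have : (fun z => segmentAverage w (aw t) h z)
          = fun z => h⁻¹ • (a t (z + h • w) - a t z) := funext (eA t)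
        change HasLineDerivAt ℝ (fun z => segmentAverage w (aw t) h z) _ _ _
        rw [this]
        exact HasLineDerivAt.const_smul' _
          (HasLineDerivAt.sub' (HasLineDerivAt.comp_add_right (da k t) _ z) (da k t z))
      · exact hSc.comp (f := fun p : ℝ × E => (h, p.1, p.2)) (by fun_prop)
      · intro t ht z
        have hd1 := ((hd t ht (z + h • w)).sub (hd t ht z)).const_smul h⁻¹
        have : (fun s => segmentAverage w (aw s) h z)
          = fun s => h⁻¹ • (a s (z + h • w) - a s z) := funext fun s => eA s z
        change HasDerivWithinAt (fun s => segmentAverage w (aw s) h z) _ _ _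
        rw [this]
        refine hd1.congr_deriv ?_
        simp only [S, eA, segmentAverage_eq (comp_t t (hBw _)) (dBw _ t) hne,
          segmentAverage_eq (comp_t t hΦw) (dΦw t) hne, Complex.real_smul, smul_eq_mul]
        push_cast
        have e2 : ∀ k, (h : ℂ)⁻¹ * ((B k t (z + h • w) : ℂ) - B k t z) * a' k t (z + h • w)
            = (h : ℂ)⁻¹ * (B k t (z + h • w) * a' k t (z + h • w))
              - (h : ℂ)⁻¹ * (B k t z * a' k t (z + h • w)) := fun k => by ring
        have e3 : ∀ k, (B k t z : ℂ) * ((h : ℂ)⁻¹ * (a' k t (z + h • w) - a' k t z))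
            = (h : ℂ)⁻¹ * (B k t z * a' k t (z + h • w))
              - (h : ℂ)⁻¹ * (B k t z * a' k t z) := fun k => by ring
        simp only [e2, e3, Finset.sum_sub_distrib, ← Finset.mul_sum]
        ring)
  simp only [segmentAverage_zero, S, zero_smul, add_zero] at key
  rw [setIntegral_eq_integral_of_eq_zero_off (fun z hz => by
      rw [h0w T hT' z (fun hc => hz (hKK' hc))]; simp),
    setIntegral_eq_integral_of_eq_zero_off (fun z hz => by
      rw [h0w 0 h0' z (fun hc => hz (hKK' hc))]; simp)] at key
  rw [key]
  refine intervalIntegral.integral_congr fun t ht => ?_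
  rw [uIcc_of_le hT] at ht
  refine setIntegral_eq_integral_of_eq_zero_off fun z hz => ?_
  rw [h0w t ht z (fun hc => hz (hKK' hc))]
  simp

end Energy

/-! ### Grönwall and Cauchy-Schwarz -/

/-- The right-hand side of `h` times `exp (-∫ κ)` is nonincreasing: its derivative is `κ` times the
difference of the two sides of `h`, times the exponential. The integral form needs no
differentiability of `y` and fits the integrated energy identities. -/
theorem gronwall_integral {y κ : ℝ → ℝ} (hy : Continuous y) (hκ : Continuous κ) {y₀ : ℝ}
    (hκ0 : ∀ t, 0 ≤ κ t)
    (h : ∀ t, 0 ≤ t → y t ≤ y₀ + ∫ τ in (0 : ℝ)..t, κ τ * y τ) {t : ℝ} (ht : 0 ≤ t) :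
    y t ≤ y₀ * Real.exp (∫ τ in (0 : ℝ)..t, κ τ) := by
  have hY : ∀ s, HasDerivAt (fun s => y₀ + ∫ τ in (0 : ℝ)..s, κ τ * y τ) (κ s * y s) s := fun s =>
    (intervalIntegral.integral_hasDerivAt_right ((hκ.mul hy).intervalIntegrable _ _)
      (hκ.mul hy).stronglyMeasurable.stronglyMeasurableAtFilter
      (hκ.mul hy).continuousAt).const_add y₀
  have hI : ∀ s, HasDerivAt (fun s => ∫ τ in (0 : ℝ)..s, κ τ) (κ s) s := fun s =>
    intervalIntegral.integral_hasDerivAt_right (hκ.intervalIntegrable _ _)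
      hκ.stronglyMeasurable.stronglyMeasurableAtFilter hκ.continuousAt
  have hP : ∀ s, HasDerivAt (fun s => (y₀ + ∫ τ in (0 : ℝ)..s, κ τ * y τ) *
      Real.exp (-∫ τ in (0 : ℝ)..s, κ τ)) _ s := fun s => (hY s).mul ((hI s).neg.exp)
  have anti : AntitoneOn (fun s => (y₀ + ∫ τ in (0 : ℝ)..s, κ τ * y τ) *
      Real.exp (-∫ τ in (0 : ℝ)..s, κ τ)) (Ici 0) := by
    refine antitoneOn_of_deriv_nonpos (convex_Ici 0)
      (fun s _ => (hP s).continuousAt.continuousWithinAt)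
      (fun s _ => (hP s).differentiableAt.differentiableWithinAt) fun s hs => ?_
    rw [interior_Ici] at hs
    rw [(hP s).deriv]
    have h1 := mul_le_mul_of_nonneg_left (h s (le_of_lt hs)) (hκ0 s)
    have h2 := mul_le_mul_of_nonneg_right h1 (Real.exp_pos (-∫ τ in (0 : ℝ)..s, κ τ)).le
    simp only [Pi.neg_apply]
    linarith
  have h1 := anti (mem_Ici.2 le_rfl) (mem_Ici.2 ht) ht
  simp only [intervalIntegral.integral_same, add_zero, neg_zero, Real.exp_zero, mul_one] at h1
  rw [Real.exp_neg, ← div_eq_mul_inv, div_le_iff₀ (Real.exp_pos _)] at h1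
  exact (h t ht).trans h1

/-- The integral of `(s f - g)²` is a nonnegative quadratic polynomial in `s`, so its discriminant
is at most zero. -/
theorem integral_mul_le_sqrt_mul_sqrt {α : Type*} [MeasurableSpace α] {μ : Measure α} {f g : α → ℝ}
    (hf : Integrable (fun x => f x ^ 2) μ) (hg : Integrable (fun x => g x ^ 2) μ)
    (hfg : Integrable (fun x => f x * g x) μ) :
    ∫ x, f x * g x ∂μ ≤ √(∫ x, f x ^ 2 ∂μ) * √(∫ x, g x ^ 2 ∂μ) := by
  have key : ∀ s r : ℝ, 2 * (s * r) * ∫ x, f x * g x ∂μ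
      ≤ s ^ 2 * ∫ x, f x ^ 2 ∂μ + r ^ 2 * ∫ x, g x ^ 2 ∂μ := by
    intro s r
    rw [← integral_const_mul, ← integral_const_mul, ← integral_const_mul,
      ← integral_add (hf.const_mul _) (hg.const_mul _)]
    refine integral_mono (hfg.const_mul _) ((hf.const_mul _).add (hg.const_mul _)) fun x => ?_
    nlinarith [sq_nonneg (s * f x - r * g x)]
  have hA : 0 ≤ ∫ x, f x ^ 2 ∂μ := integral_nonneg fun x => sq_nonneg _
  have hB : 0 ≤ ∫ x, g x ^ 2 ∂μ := integral_nonneg fun x => sq_nonneg _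
  set A := ∫ x, f x ^ 2 ∂μ
  set B := ∫ x, g x ^ 2 ∂μ
  set P := ∫ x, f x * g x ∂μ
  have hd : discrim A (-(2 * P)) B ≤ 0 := discrim_le_zero fun s => by
    have := key s 1
    nlinarith
  rw [← Real.sqrt_mul hA]
  refine Real.le_sqrt_of_sq_le ?_
  unfold discrim at hd
  nlinarith

end HamiltonVlasov

namespace HamiltonVlasov

variable {d : ℕ}

instance isAddHaarMeasure_volume_phaseSpace :
    (volume : Measure (PhaseSpace d)).IsAddHaarMeasure :=
  inferInstanceAs ((volume : Measure (Space d)).prod volume).IsAddHaarMeasure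

/-! ### Bounds for the derivatives of the potential -/

/-- The partial derivative of `k` in the `i`-th direction. -/
noncomputable def partialDeriv (k : Space d → ℝ) (i : Fin d) (x : Space d) : ℝ :=
  fderiv ℝ k x (EuclideanSpace.single i 1)

theorem contDiff_partialDeriv {k : Space d → ℝ} {m n : WithTop ℕ∞} (hk : ContDiff ℝ n k)
    (hmn : m + 1 ≤ n) (i : Fin d) : ContDiff ℝ m (partialDeriv k i) :=
  (hk.fderiv_right hmn).clm_apply contDiff_const

theorem RegularPotential.iteratedFDeriv_le {Γ : Space d → ℝ} (hΓ : RegularPotential Γ) {k : ℕ}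
    (hk : k ∈ Finset.Icc 1 2) (x : Space d) : ‖iteratedFDeriv ℝ k Γ x‖ ≤ potConst Γ := by
  have hb := hΓ.bddAbove k (Finset.Icc_subset_Icc_right (by norm_num) hk)
  have h1 := le_ciSup hb x
  rw [Finset.mem_Icc] at hk
  obtain rfl | rfl : k = 1 ∨ k = 2 := by omega
  · exact h1.trans (le_max_left _ _)
  · exact h1.trans ((le_max_left _ _).trans (le_max_right _ _))

theorem RegularPotential.norm_fderiv_le {Γ : Space d → ℝ} (hΓ : RegularPotential Γ) (x : Space d) :
    ‖fderiv ℝ Γ x‖ ≤ potConst Γ := by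
  rw [← norm_iteratedFDeriv_one]
  exact hΓ.iteratedFDeriv_le (by simp) x

theorem RegularPotential.potConst_nonneg {Γ : Space d → ℝ} (hΓ : RegularPotential Γ) :
    0 ≤ potConst Γ :=
  (norm_nonneg _).trans (hΓ.norm_fderiv_le 0)

theorem RegularPotential.norm_fderiv_fderiv_le {Γ : Space d → ℝ} (hΓ : RegularPotential Γ)
    (x : Space d) : ‖fderiv ℝ (fderiv ℝ Γ) x‖ ≤ potConst Γ := by
  refine (le_of_eq ?_).trans (hΓ.iteratedFDeriv_le (k := 2) (by simp) x)
  rw [← norm_iteratedFDeriv_one, norm_iteratedFDeriv_fderiv]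

theorem fderiv_partialDeriv {Γ : Space d → ℝ} (hΓ : ContDiff ℝ 2 Γ) (i : Fin d) (x ξ : Space d) :
    fderiv ℝ (partialDeriv Γ i) x ξ
      = fderiv ℝ (fderiv ℝ Γ) x ξ (EuclideanSpace.single i 1) := by
  have h1 : DifferentiableAt ℝ (fderiv ℝ Γ) x :=
    (hΓ.fderiv_right (m := 1) (by norm_num)).differentiable (by norm_num) x
  have h2 := (h1.hasFDerivAt.clm_apply (hasFDerivAt_const (EuclideanSpace.single i (1 : ℝ)) x))
  unfold partialDeriv
  rw [h2.fderiv]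
  simp

theorem sum_smul_single (c : Fin d → ℝ) :
    ∑ i, c i • (EuclideanSpace.single i 1 : Space d) = WithLp.toLp 2 c := by
  ext j
  simp [Pi.single_apply]

/-- The form is tested on the vector of its own coefficients. This is what keeps later constants
free of the dimension: gradients are contracted with the operator norm instead of being summed
coordinate by coordinate. -/
theorem sum_sq_linear_le (L : Space d →L[ℝ] ℝ) :
    ∑ i, L (EuclideanSpace.single i 1) ^ 2 ≤ ‖L‖ ^ 2 := by
  set c : Fin d → ℝ := fun i => L (EuclideanSpace.single i 1)
  have h1 : L (WithLp.toLp 2 c) = ∑ i, c i ^ 2 := by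
    rw [← sum_smul_single, map_sum]
    simp [c, sq]
  have h2 : ‖(WithLp.toLp 2 c : Space d)‖ ^ 2 = ∑ i, c i ^ 2 := by
    rw [EuclideanSpace.norm_sq_eq]
    simp
  have h3 := L.le_opNorm (WithLp.toLp 2 c)
  rw [h1, ← h2, Real.norm_eq_abs, abs_of_nonneg (sq_nonneg _)] at h3
  rw [← h2]
  rcases (norm_nonneg (WithLp.toLp 2 c : Space d)).eq_or_lt with h0 | h0
  · rw [← h0, zero_pow two_ne_zero]; positivity
  · have : ‖(WithLp.toLp 2 c : Space d)‖ ≤ ‖L‖ := by nlinarith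
    gcongr

theorem norm_sum_mul_le {ι : Type*} [Fintype ι] (a b : ι → ℂ) :
    ‖∑ i, a i * b i‖ ≤ √(∑ i, ‖a i‖ ^ 2) * √(∑ i, ‖b i‖ ^ 2) := by
  refine (norm_sum_le _ _).trans ?_
  simp only [norm_mul]
  exact Real.sum_mul_le_sqrt_mul_sqrt _ _ _

theorem norm_sum_linear_le (L : Space d →L[ℝ] ℝ) (b : Fin d → ℂ) :
    ‖∑ j, (L (EuclideanSpace.single j 1) : ℂ) * b j‖ ≤ ‖L‖ * √(∑ j, ‖b j‖ ^ 2) := by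
  refine (norm_sum_mul_le _ _).trans ?_
  gcongr
  refine Real.sqrt_le_iff.2 ⟨norm_nonneg _, ?_⟩
  simpa using sum_sq_linear_le L

/-- A real bilinear form keeps its norm when extended to complex vectors. After Cauchy-Schwarz in
`a`, the real and imaginary parts of `b` contribute separately to the sum of squares, and each is
controlled by `sum_sq_linear_le`. -/
theorem norm_sum_bilinear_le (L : Space d →L[ℝ] Space d →L[ℝ] ℝ) (a b : Fin d → ℂ) :
    ‖∑ i, ∑ j, (L (EuclideanSpace.single i 1) (EuclideanSpace.single j 1) : ℂ) * (a i * b j)‖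
      ≤ ‖L‖ * (√(∑ i, ‖a i‖ ^ 2) * √(∑ j, ‖b j‖ ^ 2)) := by
  have real : ∀ c : Fin d → ℝ, ∑ i, (L (EuclideanSpace.single i 1) (WithLp.toLp 2 c)) ^ 2
      ≤ ‖L‖ ^ 2 * ∑ j, c j ^ 2 := fun c => by
    have h := sum_sq_linear_le (L.flip (WithLp.toLp 2 c))
    simp only [ContinuousLinearMap.flip_apply] at h
    refine h.trans ?_
    have h2 : ‖(WithLp.toLp 2 c : Space d)‖ ^ 2 = ∑ i, c i ^ 2 := by
      rw [EuclideanSpace.norm_sq_eq]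
      simp
    rw [← h2, ← mul_pow]
    have := (L.flip).le_opNorm (WithLp.toLp 2 c)
    rw [ContinuousLinearMap.opNorm_flip] at this
    gcongr
  have e1 : ∀ i, ∑ j, (L (EuclideanSpace.single i 1) (EuclideanSpace.single j 1) : ℂ) * b j
      = (L (EuclideanSpace.single i 1) (WithLp.toLp 2 fun j => (b j).re) : ℂ)
        + (L (EuclideanSpace.single i 1) (WithLp.toLp 2 fun j => (b j).im) : ℂ) * Complex.I := by
    intro i
    rw [← sum_smul_single, ← sum_smul_single, map_sum, map_sum]
    push_cast
    rw [Finset.sum_mul, ← Finset.sum_add_distrib]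
    refine Finset.sum_congr rfl fun j _ => ?_
    simp only [map_smul, smul_eq_mul, Complex.ofReal_mul]
    conv_lhs => rw [← Complex.re_add_im (b j)]
    ring
  have e2 : ∑ i, ∑ j, (L (EuclideanSpace.single i 1) (EuclideanSpace.single j 1) : ℂ) * (a i * b j)
      = ∑ i, a i * ∑ j, (L (EuclideanSpace.single i 1) (EuclideanSpace.single j 1) : ℂ) * b j := by
    refine Finset.sum_congr rfl fun i _ => ?_
    rw [Finset.mul_sum]
    exact Finset.sum_congr rfl fun j _ => by ring
  rw [e2]
  refine (norm_sum_mul_le _ _).trans ?_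
  rw [mul_left_comm]
  gcongr
  refine Real.sqrt_le_iff.2 ⟨by positivity, ?_⟩
  rw [mul_pow, Real.sq_sqrt (by positivity)]
  have e3 : ∀ i, ‖∑ j, (L (EuclideanSpace.single i 1) (EuclideanSpace.single j 1) : ℂ) * b j‖ ^ 2
      = L (EuclideanSpace.single i 1) (WithLp.toLp 2 fun j => (b j).re) ^ 2
        + L (EuclideanSpace.single i 1) (WithLp.toLp 2 fun j => (b j).im) ^ 2 := fun i => by
    rw [e1, Complex.sq_norm, Complex.normSq_add_mul_I]
  have e4 : ∑ j, ‖b j‖ ^ 2 = ∑ j, (b j).re ^ 2 + ∑ j, (b j).im ^ 2 := by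
    rw [← Finset.sum_add_distrib]
    refine Finset.sum_congr rfl fun j _ => ?_
    rw [Complex.sq_norm, Complex.normSq_apply]
    ring
  simp only [e3, Finset.sum_add_distrib]
  rw [e4, mul_add]
  exact add_le_add (real _) (real _)

/-! ### Convolutions -/

theorem continuous_conv {k : Space d → ℝ} (hk : Continuous k) {f : ℝ → PhaseSpace d → ℂ}
    (hf : Continuous (fun p : ℝ × PhaseSpace d => f p.1 p.2))
    (hs : ∀ T : ℝ, ∃ K : Set (PhaseSpace d), IsCompact K ∧ ∀ t ≤ T, ∀ z, z ∉ K → f t z = 0) :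
    Continuous (fun p : ℝ × Space d => conv k (f p.1) p.2) := by
  rw [continuous_iff_continuousAt]
  intro p₀
  obtain ⟨K, hK, h0⟩ := hs (p₀.1 + 1)
  have h1 : Continuous (fun p : ℝ × Space d => ∫ z in K, k (p.2 - z.1) • f p.1 z) := by
    refine continuous_parametric_integral_of_continuous
      (f := fun (p : ℝ × Space d) z => k (p.2 - z.1) • f p.1 z) ?_ hK
    have : Continuous (fun q : (ℝ × Space d) × PhaseSpace d => f q.1.1 q.2) :=
      hf.comp (f := fun q : (ℝ × Space d) × PhaseSpace d => (q.1.1, q.2)) (by fun_prop)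
    fun_prop
  refine h1.continuousAt.congr ?_
  have h2 : ∀ᶠ p : ℝ × Space d in 𝓝 p₀, p.1 < p₀.1 + 1 :=
    (continuous_fst.tendsto p₀).eventually (Iio_mem_nhds (lt_add_one _))
  filter_upwards [h2] with p hp
  exact setIntegral_eq_integral_of_eq_zero_off fun z hz => by rw [h0 _ hp.le z hz, smul_zero]

theorem continuous_conv_right {k : Space d → ℝ} (hk : Continuous k) {f : PhaseSpace d → ℂ}
    (hf : Continuous f) (hf0 : HasCompactSupport f) : Continuous (conv k f) :=
  (continuous_conv hk (f := fun _ => f) (by fun_prop) fun _ => ⟨tsupport f, hf0, fun _ _ _ hz =>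
    image_eq_zero_of_notMem_tsupport hz⟩).comp (f := fun x => ((0 : ℝ), x)) (by fun_prop)

theorem exists_hasFDerivAt_conv {k : Space d → ℝ} (hk : ContDiff ℝ 1 k) {C : ℝ}
    (hC : ∀ x, ‖fderiv ℝ k x‖ ≤ C) {f : PhaseSpace d → ℂ} (hf : Continuous f)
    (hf0 : HasCompactSupport f) (x : Space d) :
    ∃ L : Space d →L[ℝ] ℂ, HasFDerivAt (conv k f) L x ∧
      ∀ i, L (EuclideanSpace.single i 1) = conv (partialDeriv k i) f x := by
  have hkd := hk.differentiable (by norm_num)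
  have hkc : Continuous k := hk.continuous
  have hkf : Continuous (fderiv ℝ k) := hk.continuous_fderiv (by norm_num)
  have hint : ∀ {V : Type} [NormedAddCommGroup V] [NormedSpace ℝ V] (g : PhaseSpace d → V),
      Continuous g → (∀ z, f z = 0 → g z = 0) → Integrable g := fun g hg h0 =>
    hg.integrable_of_hasCompactSupport (hf0.mono fun z hz hz' => hz (h0 z hz'))
  have hc : Continuous (fun z : PhaseSpace d =>
      (fderiv ℝ k (x - z.1)).smulRight (f z)) := by
    have h1 : Continuous (fun z : PhaseSpace d => fderiv ℝ k (x - z.1)) := by fun_prop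
    exact (ContinuousLinearMap.smulRightL ℝ (Space d) ℂ).continuous₂.comp (h1.prodMk hf)
  have hi := hint _ hc (fun z hz => by simp [hz])
  refine ⟨∫ z : PhaseSpace d, (fderiv ℝ k (x - z.1)).smulRight (f z), ?_, fun i => ?_⟩
  · refine hasFDerivAt_integral_of_dominated_of_fderiv_le (𝕜 := ℝ)
      (F := fun x (z : PhaseSpace d) => k (x - z.1) • f z)
      (F' := fun x (z : PhaseSpace d) => (fderiv ℝ k (x - z.1)).smulRight (f z))
      (bound := fun z => C * ‖f z‖) univ_mem ?_ ?_ hi.aestronglyMeasurable ?_ ?_ ?_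
    · filter_upwards with y
      exact Continuous.aestronglyMeasurable (by fun_prop)
    · exact hint _ (by fun_prop) (fun z hz => by simp [hz])
    · filter_upwards with z y _
      rw [ContinuousLinearMap.norm_smulRight_apply]
      gcongr
      exact hC _
    · exact hint _ (by fun_prop) (fun z hz => by simp [hz])
    · filter_upwards with z y _
      have h1 : HasFDerivAt (fun y => k (y - z.1)) (fderiv ℝ k (y - z.1)) y :=
        (hkd _).hasFDerivAt.comp y ((hasFDerivAt_id y).sub_const _)
      exact h1.smul_const (f z)
  · rw [ContinuousLinearMap.integral_apply hi]
    rfl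

theorem hasLineDerivAt_conv {k : Space d → ℝ} (hk : ContDiff ℝ 1 k) {C : ℝ}
    (hC : ∀ x, ‖fderiv ℝ k x‖ ≤ C) {f : PhaseSpace d → ℂ} (hf : Continuous f)
    (hf0 : HasCompactSupport f) (z : PhaseSpace d) (i : Fin d) :
    HasLineDerivAt ℝ (fun z : PhaseSpace d => conv k f z.1) (conv (partialDeriv k i) f z.1)
      z (dirX i) := by
  obtain ⟨L, hL, hLi⟩ := exists_hasFDerivAt_conv hk hC hf hf0 z.1
  rw [← hLi]
  exact (hL.comp z hasFDerivAt_fst).hasLineDerivAt (dirX i)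

theorem hasLineDerivAt_dirV {V : Type*} [NormedAddCommGroup V] [NormedSpace ℝ V]
    (g : Space d → V) (z : PhaseSpace d) (i : Fin d) :
    HasLineDerivAt ℝ (fun z : PhaseSpace d => g z.1) 0 z (dirV i) := by
  unfold HasLineDerivAt
  simpa [dirV] using hasDerivAt_const (0 : ℝ) (g z.1)

theorem conv_ofReal (k : Space d → ℝ) (f : PhaseSpace d → ℝ) (x : Space d) :
    conv k (fun z => (f z : ℂ)) x = ((∫ z : PhaseSpace d, k (x - z.1) * f z : ℝ) : ℂ) := by
  rw [conv, ← integral_complex_ofReal]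
  simp

theorem ofReal_re_conv_ofReal (k : Space d → ℝ) (f : PhaseSpace d → ℝ) (x : Space d) :
    ((conv k (fun z => (f z : ℂ)) x).re : ℂ) = conv k (fun z => (f z : ℂ)) x := by
  rw [conv_ofReal, Complex.ofReal_re]

/-- Formally the bracket is the divergence `∑ ∂_{xⱼ}(f ∂_{vⱼ}g) - ∂_{vⱼ}(f ∂_{xⱼ}g)`. The kernel
does not depend on velocity, so the second part integrates to zero and the first puts its derivative
on `k`. What remains has no derivative of `f` and only velocity derivatives of `g`; all bounds for
the phase rest on this. -/
theorem conv_poisson {k : Space d → ℝ} (hk : ContDiff ℝ 1 k) {f g : PhaseSpace d → ℂ}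
    (hf : ContDiff ℝ 1 f) (hg : ContDiff ℝ 1 g) (hf0 : HasCompactSupport f) (x : Space d) :
    conv k (poisson f g) x
      = ∫ z : PhaseSpace d, ∑ j, (partialDeriv k j (x - z.1) : ℂ) * (f z * fderiv ℝ g z (dirV j)) := by
  have hkd := hk.differentiable (by norm_num)
  have hkc : Continuous k := hk.continuous
  have hpd : ∀ j, Continuous (partialDeriv k j) := fun j =>
    (contDiff_partialDeriv (m := 0) hk (by norm_num) j).continuous
  have hfc := hf.continuous
  have hgc := hg.continuous
  have hf' : ∀ w, Continuous (fun z => fderiv ℝ f z w) := fun w =>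
    (hf.continuous_fderiv (by norm_num)).clm_apply continuous_const
  have hg' : ∀ w, Continuous (fun z => fderiv ℝ g z w) := fun w =>
    (hg.continuous_fderiv (by norm_num)).clm_apply continuous_const
  have df : ∀ w z, HasLineDerivAt ℝ f (fderiv ℝ f z w) z w := fun w z =>
    (hf.differentiable (by norm_num) z).hasFDerivAt.hasLineDerivAt w
  have dg : ∀ w z, HasLineDerivAt ℝ g (fderiv ℝ g z w) z w := fun w z =>
    (hg.differentiable (by norm_num) z).hasFDerivAt.hasLineDerivAt w
  have hK : IsCompact (tsupport f) := hf0
  have h0 : ∀ z, z ∉ tsupport f → f z = 0 := fun z hz => image_eq_zero_of_notMem_tsupport hz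
  have h0' : ∀ w z, z ∉ tsupport f → fderiv ℝ f z w = 0 := fun w z hz =>
    lineDeriv_eq_zero_of_notMem hK.isClosed h0 hz (df w z)
  have hκ : ∀ (j : Fin d) (z : PhaseSpace d), HasLineDerivAt ℝ (fun z : PhaseSpace d =>
      (k (x - z.1) : ℂ)) ((-partialDeriv k j (x - z.1) : ℝ) : ℂ) z (dirX j) := fun j z => by
    refine HasLineDerivAt.ofReal ?_
    have h1 : HasFDerivAt (fun z : PhaseSpace d => x - z.1)
        (-ContinuousLinearMap.fst ℝ (Space d) (Space d)) z := hasFDerivAt_fst.const_sub x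
    have h2 := ((hkd (x - z.1)).hasFDerivAt.comp z h1).hasLineDerivAt (dirX j)
    convert! h2 using 1
    simp [partialDeriv, dirX]
  have main : ∀ j, ∫ z : PhaseSpace d, (k (x - z.1) : ℂ) *
        (fderiv ℝ f z (dirX j) * fderiv ℝ g z (dirV j)
          - fderiv ℝ f z (dirV j) * fderiv ℝ g z (dirX j))
      = ∫ z : PhaseSpace d, (partialDeriv k j (x - z.1) : ℂ) * (f z * fderiv ℝ g z (dirV j)) := by
    intro j
    have c1 := hf' (dirX j)
    have c2 := hf' (dirV j)
    have c3 := hg' (dirX j)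
    have c4 := hg' (dirV j)
    have c5 := hpd j
    -- The product `k(x - ·) f` takes the role of the first function. Its position derivative has an
    -- extra term from the kernel and its velocity derivative does not, so commuting the mixed
    -- derivatives leaves exactly that term.
    have h := integral_lineDeriv_mul_comm (μ := (volume : Measure (PhaseSpace d)))
      (f := fun z => (k (x - z.1) : ℂ) * f z) (g := g) (u := dirX j) (w := dirV j)
      (fu := fun z => ((-partialDeriv k j (x - z.1) : ℝ) : ℂ) * f z
        + (k (x - z.1) : ℂ) * fderiv ℝ f z (dirX j))
      (fw := fun z => 0 * f z + (k (x - z.1) : ℂ) * fderiv ℝ f z (dirV j))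
      (by fun_prop) hgc (by fun_prop) (by fun_prop) (hg' _) (hg' _) hK
      (fun z hz => by simp [h0 z hz])
      (fun z => HasLineDerivAt.mul' (hκ j z) (df _ z))
      (fun z => HasLineDerivAt.mul'
        (hasLineDerivAt_dirV (fun y => (k (x - y) : ℂ)) z j) (df _ z))
      (dg _) (dg _)
    rw [← sub_eq_zero, ← integral_sub] at h ⊢
    · rw [← neg_eq_zero, ← integral_neg, ← h]
      congr 1
      ext z
      push_cast
      ring
    all_goals
      refine integrable_of_eq_zero_off (by fun_prop) hK (fun z hz => ?_)
      simp [h0 z hz, h0' _ z hz]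
  rw [integral_finsetSum]
  · simp only [← main]
    rw [← integral_finsetSum]
    · simp only [conv, poisson, Complex.real_smul, Finset.mul_sum]
    · intro j _
      have c1 := hf' (dirX j)
      have c2 := hf' (dirV j)
      have c3 := hg' (dirX j)
      have c4 := hg' (dirV j)
      exact integrable_of_eq_zero_off (by fun_prop) hK (fun z hz => by simp [h0' _ z hz])
  · intro j _
    have c4 := hg' (dirV j)
    have c5 := hpd j
    exact integrable_of_eq_zero_off (by fun_prop) hK (fun z hz => by simp [h0 z hz])

end HamiltonVlasov

namespace HamiltonVlasov

variable {d : ℕ}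

/-! ### Gradients of `C¹` functions with compact support -/

/-- The length of the position gradient. -/
noncomputable def xGrad (f : PhaseSpace d → ℂ) (z : PhaseSpace d) : ℝ :=
  √(∑ i, ‖fderiv ℝ f z (dirX i)‖ ^ 2)

/-- The length of the velocity gradient. -/
noncomputable def vGrad (f : PhaseSpace d → ℂ) (z : PhaseSpace d) : ℝ :=
  √(∑ i, ‖fderiv ℝ f z (dirV i)‖ ^ 2)

/-- The squared `L²` norm. -/
noncomputable def massSq (f : PhaseSpace d → ℂ) : ℝ := ∫ z, ‖f z‖ ^ 2

/-- The squared `L²` norm of the position gradient. -/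
noncomputable def xGradSq (f : PhaseSpace d → ℂ) : ℝ := ∫ z, xGrad f z ^ 2

/-- The squared `L²` norm of the velocity gradient. -/
noncomputable def vGradSq (f : PhaseSpace d → ℂ) : ℝ := ∫ z, vGrad f z ^ 2

theorem massSq_nonneg (f : PhaseSpace d → ℂ) : 0 ≤ massSq f := integral_nonneg fun _ => sq_nonneg _
theorem xGradSq_nonneg (f : PhaseSpace d → ℂ) : 0 ≤ xGradSq f := integral_nonneg fun _ => sq_nonneg _
theorem vGradSq_nonneg (f : PhaseSpace d → ℂ) : 0 ≤ vGradSq f := integral_nonneg fun _ => sq_nonneg _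

theorem xGrad_sq (f : PhaseSpace d → ℂ) (z : PhaseSpace d) :
    xGrad f z ^ 2 = ∑ i, ‖fderiv ℝ f z (dirX i)‖ ^ 2 := Real.sq_sqrt (by positivity)

theorem vGrad_sq (f : PhaseSpace d → ℂ) (z : PhaseSpace d) :
    vGrad f z ^ 2 = ∑ i, ‖fderiv ℝ f z (dirV i)‖ ^ 2 := Real.sq_sqrt (by positivity)

/-- A function of class `C¹` with compact support. -/
structure IsC1Compact (f : PhaseSpace d → ℂ) : Prop where
  contDiff : ContDiff ℝ 1 f
  hasCompactSupport : HasCompactSupport f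

theorem norm_eq_zero_of_notMem_tsupport {f : PhaseSpace d → ℂ} {z : PhaseSpace d}
    (hz : z ∉ tsupport f) : ‖f z‖ = 0 := by
  simp [image_eq_zero_of_notMem_tsupport hz]

namespace IsC1Compact

variable {f g : PhaseSpace d → ℂ} (hf : IsC1Compact f) (hg : IsC1Compact g)
include hf

theorem continuous : Continuous f := hf.contDiff.continuous

theorem continuous_deriv (w : PhaseSpace d) : Continuous (fun z => fderiv ℝ f z w) :=
  (hf.contDiff.continuous_fderiv (by norm_num)).clm_apply continuous_const

theorem differentiable : Differentiable ℝ f := hf.contDiff.differentiable (by norm_num)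

theorem hasLineDerivAt (w z : PhaseSpace d) : HasLineDerivAt ℝ f (fderiv ℝ f z w) z w :=
  (hf.differentiable z).hasFDerivAt.hasLineDerivAt w

theorem isCompact : IsCompact (tsupport f) := hf.hasCompactSupport

theorem deriv_eq_zero {z : PhaseSpace d} (hz : z ∉ tsupport f) (w : PhaseSpace d) :
    fderiv ℝ f z w = 0 :=
  lineDeriv_eq_zero_of_notMem hf.isCompact.isClosed (fun _ => image_eq_zero_of_notMem_tsupport) hz (hf.hasLineDerivAt w z)

theorem xGrad_eq_zero {z : PhaseSpace d} (hz : z ∉ tsupport f) : xGrad f z = 0 := by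
  simp [xGrad, hf.deriv_eq_zero hz]

theorem vGrad_eq_zero {z : PhaseSpace d} (hz : z ∉ tsupport f) : vGrad f z = 0 := by
  simp [vGrad, hf.deriv_eq_zero hz]

theorem continuous_xGrad : Continuous (xGrad f) := by
  have := fun i : Fin d => hf.continuous_deriv (dirX i)
  unfold xGrad
  fun_prop

theorem continuous_vGrad : Continuous (vGrad f) := by
  have := fun i : Fin d => hf.continuous_deriv (dirV i)
  unfold vGrad
  fun_prop

theorem conj_isC1Compact : IsC1Compact (fun z => conj (f z)) :=
  ⟨Complex.conjCLE.contDiff.comp hf.contDiff,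
    hf.hasCompactSupport.comp_left (g := fun z : ℂ => conj z) (map_zero _)⟩

theorem fderiv_conj (w z : PhaseSpace d) :
    fderiv ℝ (fun z => conj (f z)) z w = conj (fderiv ℝ f z w) :=
  (hf.conj_isC1Compact.hasLineDerivAt w z).unique (HasLineDerivAt.conj (hf.hasLineDerivAt w z))

theorem vGrad_conj (z : PhaseSpace d) : vGrad (fun z => conj (f z)) z = vGrad f z := by
  simp [vGrad, hf.fderiv_conj]

theorem xGradSq_eq : xGradSq f = ∑ i, ∫ z, ‖fderiv ℝ f z (dirX i)‖ ^ 2 := by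
  simp only [xGradSq, xGrad_sq]
  refine integral_finsetSum _ fun i _ => ?_
  have := hf.continuous_deriv (dirX i)
  exact integrable_of_eq_zero_off (by fun_prop) hf.isCompact
    fun z hz => by simp [hf.deriv_eq_zero hz]

theorem vGradSq_eq : vGradSq f = ∑ i, ∫ z, ‖fderiv ℝ f z (dirV i)‖ ^ 2 := by
  simp only [vGradSq, vGrad_sq]
  refine integral_finsetSum _ fun i _ => ?_
  have := hf.continuous_deriv (dirV i)
  exact integrable_of_eq_zero_off (by fun_prop) hf.isCompact
    fun z hz => by simp [hf.deriv_eq_zero hz]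

theorem integrable_mul {p q : PhaseSpace d → ℝ} (hp : Continuous p) (hq : Continuous q)
    (h0 : ∀ z, z ∉ tsupport f → p z = 0) : Integrable (fun z => p z * q z) :=
  integrable_of_eq_zero_off (by fun_prop) hf.isCompact fun z hz => by simp [h0 z hz]

theorem integrable_norm_sq : Integrable (fun z => ‖f z‖ ^ 2) := by
  simp only [sq]
  exact hf.integrable_mul hf.continuous.norm hf.continuous.norm fun _ => norm_eq_zero_of_notMem_tsupport

theorem integrable_xGrad_sq : Integrable (fun z => xGrad f z ^ 2) := by
  simp only [sq]
  exact hf.integrable_mul hf.continuous_xGrad hf.continuous_xGrad fun _ => hf.xGrad_eq_zero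

theorem integrable_vGrad_sq : Integrable (fun z => vGrad f z ^ 2) := by
  simp only [sq]
  exact hf.integrable_mul hf.continuous_vGrad hf.continuous_vGrad fun _ => hf.vGrad_eq_zero

include hg

theorem sub : IsC1Compact (fun z => f z - g z) :=
  ⟨hf.contDiff.sub hg.contDiff, hf.hasCompactSupport.sub hg.hasCompactSupport⟩

theorem fderiv_sub (w z : PhaseSpace d) :
    fderiv ℝ (fun z => f z - g z) z w = fderiv ℝ f z w - fderiv ℝ g z w :=
  ((hf.sub hg).hasLineDerivAt w z).unique
    (HasLineDerivAt.sub' (hf.hasLineDerivAt w z) (hg.hasLineDerivAt w z))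

theorem integral_norm_mul_norm_le : ∫ z, ‖f z‖ * ‖g z‖ ≤ √(massSq f) * √(massSq g) :=
  integral_mul_le_sqrt_mul_sqrt hf.integrable_norm_sq hg.integrable_norm_sq
    (hf.integrable_mul hf.continuous.norm hg.continuous.norm fun _ => norm_eq_zero_of_notMem_tsupport)

theorem integral_norm_mul_vGrad_le : ∫ z, ‖f z‖ * vGrad g z ≤ √(massSq f) * √(vGradSq g) :=
  integral_mul_le_sqrt_mul_sqrt hf.integrable_norm_sq hg.integrable_vGrad_sq
    (hf.integrable_mul hf.continuous.norm hg.continuous_vGrad fun _ => norm_eq_zero_of_notMem_tsupport)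

theorem continuous_poisson : Continuous (poisson f g) := by
  have c1 := fun w => hf.continuous_deriv w
  have c2 := fun w => hg.continuous_deriv w
  unfold poisson
  fun_prop

omit hg in
theorem hasCompactSupport_poisson : HasCompactSupport (poisson f g) :=
  HasCompactSupport.intro hf.isCompact fun z hz => by simp [poisson, hf.deriv_eq_zero hz]

end IsC1Compact

/-! ### Bounds for the mean field -/

section Bounds

variable {Γ : Space d → ℝ} (hΓ : RegularPotential Γ)
include hΓ

theorem RegularPotential.contDiff_two : ContDiff ℝ 2 Γ := hΓ.contDiff.of_le (by norm_num)

theorem RegularPotential.contDiff_one : ContDiff ℝ 1 Γ := hΓ.contDiff.of_le (by norm_num)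

theorem RegularPotential.contDiff_partialDeriv (i : Fin d) : ContDiff ℝ 1 (partialDeriv Γ i) :=
  HamiltonVlasov.contDiff_partialDeriv hΓ.contDiff_two (by norm_num) i

theorem RegularPotential.continuous_partialDeriv (i : Fin d) : Continuous (partialDeriv Γ i) :=
  (hΓ.contDiff_partialDeriv i).continuous

theorem RegularPotential.continuous_partialDeriv₂ (i j : Fin d) :
    Continuous (partialDeriv (partialDeriv Γ i) j) :=
  (HamiltonVlasov.contDiff_partialDeriv (m := 0) (hΓ.contDiff_partialDeriv i) (by norm_num)
    j).continuous

theorem RegularPotential.norm_fderiv_partialDeriv_le (i : Fin d) (x : Space d) :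
    ‖fderiv ℝ (partialDeriv Γ i) x‖ ≤ potConst Γ := by
  refine ContinuousLinearMap.opNorm_le_bound _ hΓ.potConst_nonneg fun ξ => ?_
  rw [fderiv_partialDeriv hΓ.contDiff_two]
  have h1 := (fderiv ℝ (fderiv ℝ Γ) x ξ).le_opNorm (EuclideanSpace.single i 1)
  have h2 := (fderiv ℝ (fderiv ℝ Γ) x).le_of_opNorm_le (hΓ.norm_fderiv_fderiv_le x) ξ
  rw [PiLp.norm_single, norm_one, mul_one] at h1
  exact h1.trans h2

theorem norm_sum_partialDeriv_le (x : Space d) (b : Fin d → ℂ) :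
    ‖∑ j, (partialDeriv Γ j x : ℂ) * b j‖ ≤ potConst Γ * √(∑ j, ‖b j‖ ^ 2) := by
  refine (norm_sum_linear_le (fderiv ℝ Γ x) b).trans ?_
  gcongr
  exact hΓ.norm_fderiv_le x

theorem norm_sum_partialDeriv₂_le (x : Space d) (a b : Fin d → ℂ) :
    ‖∑ i, ∑ j, (partialDeriv (partialDeriv Γ j) i x : ℂ) * (a i * b j)‖
      ≤ potConst Γ * (√(∑ i, ‖a i‖ ^ 2) * √(∑ j, ‖b j‖ ^ 2)) := by
  have h := norm_sum_bilinear_le (fderiv ℝ (fderiv ℝ Γ) x) a b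
  simp only [← fderiv_partialDeriv hΓ.contDiff_two] at h
  refine h.trans ?_
  gcongr
  exact hΓ.norm_fderiv_fderiv_le x

/-- The contraction with `b` is carried out under the integral, before norms are taken, so that the
operator norm of `DΓ` enters and no factor depending on `d` appears. -/
theorem norm_sum_conv_partialDeriv_mul_le {ρ : PhaseSpace d → ℂ} (hρ : Continuous ρ)
    (hρ0 : HasCompactSupport ρ) (x : Space d) (b : Fin d → ℂ) :
    ‖∑ j, conv (partialDeriv Γ j) ρ x * b j‖
      ≤ potConst Γ * √(∑ j, ‖b j‖ ^ 2) * ∫ z, ‖ρ z‖ := by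
  have c := hΓ.continuous_partialDeriv
  have e1 : ∑ j, conv (partialDeriv Γ j) ρ x * b j
      = ∫ z : PhaseSpace d, (∑ j, (partialDeriv Γ j (x - z.1) : ℂ) * b j) * ρ z := by
    simp only [Finset.sum_mul]
    rw [integral_finsetSum]
    · refine Finset.sum_congr rfl fun j _ => ?_
      rw [conv, ← integral_mul_const]
      congr 1
      ext z
      simp only [Complex.real_smul]
      ring
    · intro j _
      have := c j
      exact integrable_of_eq_zero_off (by fun_prop) hρ0
        fun z hz => by simp [image_eq_zero_of_notMem_tsupport hz]
  rw [e1, ← integral_const_mul]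
  refine norm_integral_le_of_norm_le ?_ (Eventually.of_forall fun z => ?_)
  · exact integrable_of_eq_zero_off (by fun_prop) hρ0
      fun z hz => by simp [image_eq_zero_of_notMem_tsupport hz]
  · rw [norm_mul]
    gcongr
    exact norm_sum_partialDeriv_le hΓ _ _

theorem norm_sum_conv_partialDeriv₂_mul_le {ρ : PhaseSpace d → ℂ} (hρ : Continuous ρ)
    (hρ0 : HasCompactSupport ρ) (x : Space d) (a b : Fin d → ℂ) :
    ‖∑ i, ∑ j, conv (partialDeriv (partialDeriv Γ j) i) ρ x * (a i * b j)‖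
      ≤ potConst Γ * (√(∑ i, ‖a i‖ ^ 2) * √(∑ j, ‖b j‖ ^ 2)) * ∫ z, ‖ρ z‖ := by
  have c := hΓ.continuous_partialDeriv₂
  have hi : ∀ i j, Integrable (fun z : PhaseSpace d =>
      (partialDeriv (partialDeriv Γ j) i (x - z.1) : ℂ) * (a i * b j) * ρ z) := fun i j => by
    have := c j i
    exact integrable_of_eq_zero_off (by fun_prop) hρ0
        fun z hz => by simp [image_eq_zero_of_notMem_tsupport hz]
  have e1 : ∑ i, ∑ j, conv (partialDeriv (partialDeriv Γ j) i) ρ x * (a i * b j)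
      = ∫ z : PhaseSpace d,
        (∑ i, ∑ j, (partialDeriv (partialDeriv Γ j) i (x - z.1) : ℂ) * (a i * b j)) * ρ z := by
    simp only [Finset.sum_mul]
    rw [integral_finsetSum _ (fun i _ => integrable_finsetSum _ fun j _ => hi i j)]
    refine Finset.sum_congr rfl fun i _ => ?_
    rw [integral_finsetSum _ fun j _ => hi i j]
    refine Finset.sum_congr rfl fun j _ => ?_
    rw [conv, ← integral_mul_const]
    congr 1
    ext z
    simp only [Complex.real_smul]
    ring
  rw [e1, ← integral_const_mul]
  refine norm_integral_le_of_norm_le ?_ (Eventually.of_forall fun z => ?_)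
  · exact integrable_of_eq_zero_off (by fun_prop) hρ0
      fun z hz => by simp [image_eq_zero_of_notMem_tsupport hz]
  · rw [norm_mul]
    gcongr
    exact norm_sum_partialDeriv₂_le hΓ _ _ _

theorem norm_conv_poisson_le {f g : PhaseSpace d → ℂ} (hf : IsC1Compact f) (hg : IsC1Compact g)
    (x : Space d) :
    ‖conv Γ (poisson f g) x‖ ≤ potConst Γ * ∫ z, ‖f z‖ * vGrad g z := by
  rw [conv_poisson hΓ.contDiff_one hf.contDiff hg.contDiff hf.hasCompactSupport,
    ← integral_const_mul]
  refine norm_integral_le_of_norm_le ?_ (Eventually.of_forall fun z => ?_)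
  · exact (hf.integrable_mul hf.continuous.norm hg.continuous_vGrad
      fun _ => norm_eq_zero_of_notMem_tsupport).const_mul _
  · have e : ∑ j, (partialDeriv Γ j (x - z.1) : ℂ) * (f z * fderiv ℝ g z (dirV j))
        = f z * ∑ j, (partialDeriv Γ j (x - z.1) : ℂ) * fderiv ℝ g z (dirV j) := by
      rw [Finset.mul_sum]
      exact Finset.sum_congr rfl fun j _ => by ring
    rw [e, norm_mul, mul_left_comm]
    gcongr
    exact norm_sum_partialDeriv_le hΓ _ _

/-- After integration by parts the contraction is the second derivative of `Γ`, evaluated on `a` and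
on the velocity gradient of `g`. -/
theorem norm_sum_mul_conv_partialDeriv_poisson_le {f g : PhaseSpace d → ℂ} (hf : IsC1Compact f)
    (hg : IsC1Compact g) (x : Space d) (a : Fin d → ℂ) :
    ‖∑ i, a i * conv (partialDeriv Γ i) (poisson f g) x‖
      ≤ potConst Γ * √(∑ i, ‖a i‖ ^ 2) * ∫ z, ‖f z‖ * vGrad g z := by
  have c := hΓ.continuous_partialDeriv₂
  have hi : ∀ i, Integrable (fun z : PhaseSpace d => ∑ j,
      (partialDeriv (partialDeriv Γ i) j (x - z.1) : ℂ) * (f z * fderiv ℝ g z (dirV j))) :=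
    fun i => by
      have := fun w => hg.continuous_deriv w
      have := hf.continuous
      have := c i
      exact integrable_of_eq_zero_off (by fun_prop) hf.isCompact fun z hz => by
        simp [image_eq_zero_of_notMem_tsupport hz]
  have e1 : ∑ i, a i * conv (partialDeriv Γ i) (poisson f g) x
      = ∫ z : PhaseSpace d, ∑ i, a i * ∑ j,
        (partialDeriv (partialDeriv Γ i) j (x - z.1) : ℂ) * (f z * fderiv ℝ g z (dirV j)) := by
    rw [integral_finsetSum _ fun i _ => (hi i).const_mul _]
    refine Finset.sum_congr rfl fun i _ => ?_
    rw [conv_poisson (hΓ.contDiff_partialDeriv i) hf.contDiff hg.contDiff hf.hasCompactSupport,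
      integral_const_mul]
  rw [e1, ← integral_const_mul]
  refine norm_integral_le_of_norm_le ?_ (Eventually.of_forall fun z => ?_)
  · exact (hf.integrable_mul hf.continuous.norm hg.continuous_vGrad
      fun _ => norm_eq_zero_of_notMem_tsupport).const_mul _
  · have e : ∑ i, a i * ∑ j,
        (partialDeriv (partialDeriv Γ i) j (x - z.1) : ℂ) * (f z * fderiv ℝ g z (dirV j))
        = f z * ∑ j, ∑ i, (partialDeriv (partialDeriv Γ i) j (x - z.1) : ℂ)
          * (fderiv ℝ g z (dirV j) * a i) := by
      rw [Finset.sum_comm, Finset.mul_sum]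
      refine Finset.sum_congr rfl fun i _ => ?_
      rw [Finset.mul_sum, Finset.mul_sum]
      exact Finset.sum_congr rfl fun j _ => by ring
    rw [e, norm_mul]
    have h := norm_sum_partialDeriv₂_le hΓ (x - z.1) (fun j => fderiv ℝ g z (dirV j)) a
    refine (mul_le_mul_of_nonneg_left h (norm_nonneg _)).trans_eq ?_
    unfold vGrad
    ring

end Bounds

end HamiltonVlasov

namespace HamiltonVlasov

variable {d : ℕ}

/-! ### The transport form of the equation -/

/-- The coordinate directions of phase space. -/
noncomputable def phaseDir : Fin d ⊕ Fin d → PhaseSpace d := Sum.elim dirX dirV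

/-- The density `|f|²`. -/
noncomputable def density (f : PhaseSpace d → ℂ) (z : PhaseSpace d) : ℂ := ((‖f z‖ ^ 2 : ℝ) : ℂ)

theorem ofReal_re_conv_density (k : Space d → ℝ) (f : PhaseSpace d → ℂ) (x : Space d) :
    ((conv k (density f) x).re : ℂ) = conv k (density f) x :=
  ofReal_re_conv_ofReal k (fun z => ‖f z‖ ^ 2) x

/-- The bracket `[f̄, f]`. -/
noncomputable def selfBracket (f : PhaseSpace d → ℂ) : PhaseSpace d → ℂ :=
  poisson (fun z => conj (f z)) f

/-- The Hamiltonian vector field, with the sign with which it transports functions. -/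
noncomputable def drift (Γ : Space d → ℝ) (f : PhaseSpace d → ℂ) :
    Fin d ⊕ Fin d → PhaseSpace d → ℝ :=
  Sum.elim (fun j z => -z.2 j) fun j z => (conv (partialDeriv Γ j) (density f) z.1).re

/-- The derivatives of `drift` in the coordinate directions. -/
noncomputable def driftDeriv (Γ : Space d → ℝ) (f : PhaseSpace d → ℂ) (w : Fin d ⊕ Fin d) :
    Fin d ⊕ Fin d → PhaseSpace d → ℝ :=
  Sum.elim (fun j _ => Sum.elim (fun _ => 0) (fun i => if i = j then -1 else 0) w)
    fun j z => Sum.elim (fun i => (conv (partialDeriv (partialDeriv Γ j) i) (density f) z.1).re)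
      (fun _ => 0) w

/-- The potential `Γ * [f̄, f]`. -/
noncomputable def phase (Γ : Space d → ℝ) (f : PhaseSpace d → ℂ) (z : PhaseSpace d) : ℂ :=
  conv Γ (selfBracket f) z.1

/-- The derivatives of `phase` in the coordinate directions. -/
noncomputable def phaseDeriv (Γ : Space d → ℝ) (f : PhaseSpace d → ℂ) (w : Fin d ⊕ Fin d)
    (z : PhaseSpace d) : ℂ :=
  Sum.elim (fun i => conv (partialDeriv Γ i) (selfBracket f) z.1) (fun _ => 0) w

section

variable {f : PhaseSpace d → ℂ} (hf : IsC1Compact f)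
include hf

theorem IsC1Compact.continuous_density : Continuous (density f) := by
  have := hf.continuous
  unfold density
  fun_prop

theorem IsC1Compact.hasCompactSupport_density : HasCompactSupport (density f) :=
  HasCompactSupport.intro hf.isCompact fun z hz => by
    simp [density, image_eq_zero_of_notMem_tsupport hz]

theorem IsC1Compact.continuous_selfBracket : Continuous (selfBracket f) :=
  hf.conj_isC1Compact.continuous_poisson hf

theorem IsC1Compact.hasCompactSupport_selfBracket : HasCompactSupport (selfBracket f) :=
  hf.conj_isC1Compact.hasCompactSupport_poisson

/-- Conjugation exchanges the two entries of an antisymmetric bracket. Convolution with the real `Γ`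
keeps the bracket's values imaginary, which makes the potential term skew-adjoint. -/
theorem conj_selfBracket (z : PhaseSpace d) : conj (selfBracket f z) = -selfBracket f z := by
  simp only [selfBracket, poisson, hf.fderiv_conj, map_sum, map_sub, map_mul, Complex.conj_conj,
    ← Finset.sum_neg_distrib]
  exact Finset.sum_congr rfl fun i _ => by ring

theorem phase_re (Γ : Space d → ℝ) (z : PhaseSpace d) : (phase Γ f z).re = 0 := by
  have h : conj (phase Γ f z) = -phase Γ f z := by
    rw [phase, conv, ← integral_conj, ← integral_neg]
    congr 1
    ext y
    rw [Complex.real_smul, map_mul, conj_selfBracket hf, Complex.conj_ofReal, mul_neg]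
  have := congrArg Complex.re h
  simp only [Complex.conj_re, Complex.neg_re] at this
  linarith

theorem hasLineDerivAt_drift {Γ : Space d → ℝ} (hΓ : RegularPotential Γ) (w k : Fin d ⊕ Fin d)
    (z : PhaseSpace d) :
    HasLineDerivAt ℝ (drift Γ f k) (driftDeriv Γ f w k z) z (phaseDir w) := by
  have hlin : ∀ j : Fin d, HasFDerivAt (fun z : PhaseSpace d => -z.2 j)
      (-(EuclideanSpace.proj j).comp (ContinuousLinearMap.snd ℝ (Space d) (Space d))) z := fun j =>
    ((EuclideanSpace.proj (𝕜 := ℝ) j).comp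
      (ContinuousLinearMap.snd ℝ (Space d) (Space d))).hasFDerivAt.neg
  rcases k with j | j
  · have h := (hlin j).hasLineDerivAt (phaseDir w)
    convert! h using 1
    rcases w with i | i
    · simp [driftDeriv, phaseDir, dirX]
    · simp [driftDeriv, phaseDir, dirV, apply_ite, eq_comm]
  · rcases w with i | i
    · have h := hasLineDerivAt_conv (hΓ.contDiff_partialDeriv j) (hΓ.norm_fderiv_partialDeriv_le j)
        hf.continuous_density hf.hasCompactSupport_density z i
      unfold HasLineDerivAt at h
      exact Complex.reCLM.hasFDerivAt.comp_hasDerivAt (0 : ℝ) h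
    · exact hasLineDerivAt_dirV (fun x => (conv (partialDeriv Γ j) (density f) x).re) z i

theorem hasLineDerivAt_phase {Γ : Space d → ℝ} (hΓ : RegularPotential Γ) (w : Fin d ⊕ Fin d)
    (z : PhaseSpace d) :
    HasLineDerivAt ℝ (phase Γ f) (phaseDeriv Γ f w z) z (phaseDir w) := by
  rcases w with i | i
  · exact hasLineDerivAt_conv hΓ.contDiff_one hΓ.norm_fderiv_le
      hf.continuous_selfBracket hf.hasCompactSupport_selfBracket z i
  · exact hasLineDerivAt_dirV (fun x => conv Γ (selfBracket f) x) z i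

omit hf in
-- The position components of the field depend on `v` alone and the velocity components on `x`
-- alone, so the divergence vanishes term by term.
theorem driftDeriv_self (Γ : Space d → ℝ) (k : Fin d ⊕ Fin d) (z : PhaseSpace d) :
    driftDeriv Γ f k k z = 0 := by
  rcases k with j | j <;> simp [driftDeriv]

theorem hvlRhs_eq {Γ : Space d → ℝ} (hΓ : RegularPotential Γ) (z : PhaseSpace d) :
    hvlRhs Γ f z = ∑ k, drift Γ f k z * fderiv ℝ f z (phaseDir k) - phase Γ f z * f z := by
  obtain ⟨L, hL, hLi⟩ := exists_hasFDerivAt_conv hΓ.contDiff_one hΓ.norm_fderiv_le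
    hf.continuous_density hf.hasCompactSupport_density z.1
  have h1 : HasFDerivAt (fun z : PhaseSpace d => ((‖z.2‖ ^ 2 / 2 : ℝ) : ℂ))
      (Complex.ofRealCLM.comp ((innerSL ℝ z.2).comp
        (ContinuousLinearMap.snd ℝ (Space d) (Space d)))) z := by
    have h2 : HasFDerivAt (fun z : PhaseSpace d => ‖z.2‖ ^ 2) _ z :=
      (hasFDerivAt_snd (𝕜 := ℝ) (E := Space d) (F := Space d) (p := z)).norm_sq
    have h3 := Complex.ofRealCLM.hasFDerivAt.comp z (h2.const_mul (1 / 2 : ℝ))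
    refine (h3.congr_of_eventuallyEq (Eventually.of_forall fun y => ?_)).congr_fderiv ?_
    · simp only [Function.comp, Complex.ofRealCLM_apply]
      congr 1
      ring
    · ext y <;> simp
  have h2 : HasFDerivAt (meanFieldHamiltonian Γ f) _ z :=
    h1.add (hL.comp z (hasFDerivAt_fst (𝕜 := ℝ) (E := Space d) (F := Space d) (p := z)))
  have eX : ∀ i, fderiv ℝ (meanFieldHamiltonian Γ f) z (dirX i) = drift Γ f (Sum.inr i) z := by
    intro i
    rw [h2.fderiv]
    simp only [dirX, drift, Sum.elim_inr, ofReal_re_conv_density]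
    simpa using hLi i
  have eV : ∀ i, fderiv ℝ (meanFieldHamiltonian Γ f) z (dirV i)
      = ((-drift Γ f (Sum.inl i) z : ℝ) : ℂ) := by
    intro i
    rw [h2.fderiv]
    simp [dirV, drift, EuclideanSpace.inner_single_right]
  rw [hvlRhs, poisson, Fintype.sum_sum_type]
  simp only [eX, eV, phaseDir, Sum.elim_inl, Sum.elim_inr]
  rw [← Finset.sum_add_distrib]
  congr 1
  refine Finset.sum_congr rfl fun i _ => ?_
  push_cast
  ring

/-- The growth rate of the gradient. -/
theorem integral_gradient_source_le {Γ : Space d → ℝ} (hΓ : RegularPotential Γ) :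
    ∑ w, ∫ z, 2 * (conj (fderiv ℝ f z (phaseDir w)) *
      (∑ k, driftDeriv Γ f w k z * fderiv ℝ f z (phaseDir k) - phaseDeriv Γ f w z * f z)).re
      ≤ (1 + 2 * potConst Γ * massSq f) * (xGradSq f + vGradSq f) := by
  set C := potConst Γ
  have hC : 0 ≤ C := hΓ.potConst_nonneg
  set n := ∫ z, ‖f z‖ * vGrad f z
  have hn : n ≤ √(massSq f) * √(vGradSq f) := hf.integral_norm_mul_vGrad_le hf
  have cF := hf.continuous
  have cD := fun w => hf.continuous_deriv w
  have cX := hf.continuous_xGrad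
  have cV := hf.continuous_vGrad
  have cdrift : ∀ w k, Continuous (driftDeriv Γ f w k) := by
    rintro (i | i) (j | j)
    · exact continuous_const
    · exact Complex.continuous_re.comp ((continuous_conv_right (hΓ.continuous_partialDeriv₂ j i)
        hf.continuous_density hf.hasCompactSupport_density).comp continuous_fst)
    · exact continuous_const
    · exact continuous_const
  have cphase : ∀ w, Continuous (phaseDeriv Γ f w) := by
    rintro (i | i)
    · exact (continuous_conv_right (hΓ.continuous_partialDeriv i)
        hf.continuous_selfBracket hf.hasCompactSupport_selfBracket).comp continuous_fst
    · exact continuous_const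
  have hi : ∀ w, Integrable fun z => 2 * (conj (fderiv ℝ f z (phaseDir w)) *
      (∑ k, driftDeriv Γ f w k z * fderiv ℝ f z (phaseDir k) - phaseDeriv Γ f w z * f z)).re :=
    fun w => integrable_of_eq_zero_off (by fun_prop) hf.isCompact fun z hz => by
      simp [hf.deriv_eq_zero hz]
  rw [← integral_finsetSum _ fun w _ => hi w]
  have iXV : Integrable fun z => xGrad f z * vGrad f z :=
    hf.integrable_mul cX cV fun _ => hf.xGrad_eq_zero
  have iXf : Integrable fun z => ‖f z‖ * xGrad f z :=
    hf.integrable_mul cF.norm cX fun _ => norm_eq_zero_of_notMem_tsupport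
  have pw : ∀ z, ∑ w, 2 * (conj (fderiv ℝ f z (phaseDir w)) *
      (∑ k, driftDeriv Γ f w k z * fderiv ℝ f z (phaseDir k) - phaseDeriv Γ f w z * f z)).re
      ≤ (xGrad f z ^ 2 + vGrad f z ^ 2) + (2 * C * massSq f) * (xGrad f z * vGrad f z)
        + (2 * C * n) * (‖f z‖ * xGrad f z) := by
    intro z
    rw [Fintype.sum_sum_type]
    -- The commutator of `∂_{vᵢ}` with free streaming is `-∂_{xᵢ}`, and nothing else depends on
    -- velocity. The inequality `2ab ≤ a² + b²` gives the summand 1 of the growth rate.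
    have hv : ∑ i, 2 * (conj (fderiv ℝ f z (phaseDir (Sum.inr i))) *
        (∑ k, driftDeriv Γ f (Sum.inr i) k z * fderiv ℝ f z (phaseDir k)
          - phaseDeriv Γ f (Sum.inr i) z * f z)).re ≤ xGrad f z ^ 2 + vGrad f z ^ 2 := by
      rw [xGrad_sq, vGrad_sq, ← Finset.sum_add_distrib]
      refine Finset.sum_le_sum fun i _ => ?_
      have e : (∑ k, driftDeriv Γ f (Sum.inr i) k z * fderiv ℝ f z (phaseDir k)
          - phaseDeriv Γ f (Sum.inr i) z * f z) = -fderiv ℝ f z (dirX i) := by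
        rw [Fintype.sum_sum_type]
        simp [driftDeriv, phaseDeriv, phaseDir, apply_ite]
      rw [e]
      have h1 : (conj (fderiv ℝ f z (dirV i)) * -fderiv ℝ f z (dirX i)).re
          ≤ ‖fderiv ℝ f z (dirV i)‖ * ‖fderiv ℝ f z (dirX i)‖ := by
        refine (Complex.re_le_norm _).trans_eq ?_
        rw [norm_mul, norm_neg, RCLike.norm_conj]
      have h2 := two_mul_le_add_sq ‖fderiv ℝ f z (dirX i)‖ ‖fderiv ℝ f z (dirV i)‖
      simp only [phaseDir, Sum.elim_inr]
      nlinarith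
    -- In the position directions the field contributes `D²Γ * |f|²`, paired with both gradients,
    -- and the phase contributes `DΓ * [f̄, f]`, paired with `f` and the position gradient.
    have hx : ∑ i, 2 * (conj (fderiv ℝ f z (phaseDir (Sum.inl i))) *
        (∑ k, driftDeriv Γ f (Sum.inl i) k z * fderiv ℝ f z (phaseDir k)
          - phaseDeriv Γ f (Sum.inl i) z * f z)).re
        ≤ (2 * C * massSq f) * (xGrad f z * vGrad f z) + (2 * C * n) * (‖f z‖ * xGrad f z) := by
      have e : ∑ i, 2 * (conj (fderiv ℝ f z (phaseDir (Sum.inl i))) *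
          (∑ k, driftDeriv Γ f (Sum.inl i) k z * fderiv ℝ f z (phaseDir k)
            - phaseDeriv Γ f (Sum.inl i) z * f z)).re
          = 2 * (∑ i, ∑ j, conv (partialDeriv (partialDeriv Γ j) i) (density f) z.1 *
              (conj (fderiv ℝ f z (dirX i)) * fderiv ℝ f z (dirV j))
            - (∑ i, conj (fderiv ℝ f z (dirX i)) *
              conv (partialDeriv Γ i) (selfBracket f) z.1) * f z).re := by
        rw [← Finset.mul_sum, ← Complex.re_sum, Finset.sum_mul, ← Finset.sum_sub_distrib]
        congr 3
        ext i
        rw [Fintype.sum_sum_type]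
        simp only [driftDeriv, phaseDeriv, phaseDir, Sum.elim_inl, Sum.elim_inr,
          ofReal_re_conv_density, Complex.ofReal_zero, zero_mul, Finset.sum_const_zero, zero_add]
        rw [mul_sub, Finset.mul_sum, mul_assoc]
        congr 1
        exact Finset.sum_congr rfl fun j _ => by ring
      rw [e]
      have b1 := norm_sum_conv_partialDeriv₂_mul_le hΓ hf.continuous_density
        hf.hasCompactSupport_density z.1 (fun i => conj (fderiv ℝ f z (dirX i)))
        (fun j => fderiv ℝ f z (dirV j))
      have b2 := norm_sum_mul_conv_partialDeriv_poisson_le hΓ hf.conj_isC1Compact hf z.1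
        (fun i => conj (fderiv ℝ f z (dirX i)))
      have em : ∫ z, ‖density f z‖ = massSq f := by simp [density, massSq]
      simp only [RCLike.norm_conj, em] at b1 b2
      change _ ≤ C * (xGrad f z * vGrad f z) * massSq f at b1
      change _ ≤ C * xGrad f z * n at b2
      have b3 := (Complex.re_le_norm _).trans (norm_sub_le
        (∑ i, ∑ j, conv (partialDeriv (partialDeriv Γ j) i) (density f) z.1 *
              (conj (fderiv ℝ f z (dirX i)) * fderiv ℝ f z (dirV j)))
        ((∑ i, conj (fderiv ℝ f z (dirX i)) *
              conv (partialDeriv Γ i) (selfBracket f) z.1) * f z))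
      rw [norm_mul] at b3
      have b4 := mul_le_mul_of_nonneg_right b2 (norm_nonneg (f z))
      unfold selfBracket at b3 ⊢
      linarith
    linarith
  have ixx : Integrable fun z => xGrad f z ^ 2 + vGrad f z ^ 2 :=
    hf.integrable_xGrad_sq.add hf.integrable_vGrad_sq
  refine (integral_mono (integrable_finsetSum _ fun w _ => hi w)
    ((ixx.add (iXV.const_mul _)).add (iXf.const_mul _)) pw).trans ?_
  rw [integral_add' (ixx.add (iXV.const_mul _)) (iXf.const_mul _),
    integral_add' ixx (iXV.const_mul _), integral_add hf.integrable_xGrad_sq hf.integrable_vGrad_sq,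
    integral_const_mul, integral_const_mul]
  have b1 : ∫ z, xGrad f z * vGrad f z ≤ √(xGradSq f) * √(vGradSq f) :=
    integral_mul_le_sqrt_mul_sqrt hf.integrable_xGrad_sq hf.integrable_vGrad_sq iXV
  have b2 : ∫ z, ‖f z‖ * xGrad f z ≤ √(massSq f) * √(xGradSq f) :=
    integral_mul_le_sqrt_mul_sqrt hf.integrable_norm_sq hf.integrable_xGrad_sq iXf
  have s1 := Real.sq_sqrt (massSq_nonneg f)
  have s2 := Real.sq_sqrt (xGradSq_nonneg f)
  have s3 := Real.sq_sqrt (vGradSq_nonneg f)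
  -- Cauchy-Schwarz in both factors makes the phase term as large as the mean field term, `massSq f
  -- * √(xGradSq f) * √(vGradSq f)`. Together they give the 2 in the rate.
  have b3 : n * ∫ z, ‖f z‖ * xGrad f z
      ≤ (√(massSq f) * √(vGradSq f)) * (√(massSq f) * √(xGradSq f)) :=
    mul_le_mul hn b2 (integral_nonneg fun z => mul_nonneg (norm_nonneg _) (Real.sqrt_nonneg _))
      (by positivity)
  have b4 : 2 * (√(xGradSq f) * √(vGradSq f)) ≤ xGradSq f + vGradSq f := by
    have := two_mul_le_add_sq √(xGradSq f) √(vGradSq f)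
    linarith
  have b5 : (√(massSq f) * √(vGradSq f)) * (√(massSq f) * √(xGradSq f))
      = massSq f * (√(xGradSq f) * √(vGradSq f)) := by
    rw [← s1]
    simp only [Real.sqrt_sq (Real.sqrt_nonneg _)]
    ring
  rw [b5] at b3
  have hm : 0 ≤ C * massSq f := mul_nonneg hC (massSq_nonneg f)
  have b6 := mul_le_mul_of_nonneg_left b1 hm
  have b7 := mul_le_mul_of_nonneg_left b3 hC
  have b8 := mul_le_mul_of_nonneg_left b4 hm
  change xGradSq f + vGradSq f + _ + _ ≤ _
  linarith

end

end HamiltonVlasov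

namespace HamiltonVlasov

variable {d : ℕ}

section

variable {f : PhaseSpace d → ℂ} {Γ : Space d → ℝ} (hf : IsC1Compact f) (hΓ : RegularPotential Γ)
include hf hΓ

theorem continuous_drift (k : Fin d ⊕ Fin d) : Continuous (drift Γ f k) := by
  rcases k with j | j
  · simp only [drift, Sum.elim_inl]
    fun_prop
  · exact Complex.continuous_re.comp ((continuous_conv_right (hΓ.continuous_partialDeriv j)
      hf.continuous_density hf.hasCompactSupport_density).comp continuous_fst)

theorem continuous_phase : Continuous (phase Γ f) :=
  (continuous_conv_right hΓ.contDiff.continuous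
    hf.continuous_selfBracket hf.hasCompactSupport_selfBracket).comp continuous_fst

end

/-! ### Sources in the equation for the difference of two solutions -/

section Difference

variable {f g : PhaseSpace d → ℂ} (hf : IsC1Compact f) (hg : IsC1Compact g)
include hf hg

theorem conv_density_sub {k : Space d → ℝ} (hk : Continuous k) (x : Space d) :
    conv k (density f) x - conv k (density g) x = conv k (fun z => density f z - density g z) x := by
  have c1 := hf.continuous_density
  have c2 := hg.continuous_density
  simp only [conv]
  rw [← integral_sub]
  · simp only [smul_sub]
  · exact integrable_of_eq_zero_off (by fun_prop) hf.hasCompactSupport_density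
      fun z hz => by rw [image_eq_zero_of_notMem_tsupport hz, smul_zero]
  · exact integrable_of_eq_zero_off (by fun_prop) hg.hasCompactSupport_density
      fun z hz => by rw [image_eq_zero_of_notMem_tsupport hz, smul_zero]

theorem integral_norm_density_sub_le :
    ∫ z, ‖density f z - density g z‖
      ≤ √(massSq fun z => f z - g z) * (√(massSq f) + √(massSq g)) := by
  have hs := hf.sub hg
  have c1 := hf.continuous
  have c2 := hg.continuous
  have i1 : Integrable fun z => ‖f z - g z‖ * ‖f z‖ :=
    hs.integrable_mul (by fun_prop) (by fun_prop) fun _ => norm_eq_zero_of_notMem_tsupport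
  have i2 : Integrable fun z => ‖f z - g z‖ * ‖g z‖ :=
    hs.integrable_mul (by fun_prop) (by fun_prop) fun _ => norm_eq_zero_of_notMem_tsupport
  rw [mul_add]
  refine le_trans ?_ (add_le_add (hs.integral_norm_mul_norm_le hf) (hs.integral_norm_mul_norm_le hg))
  rw [← integral_add i1 i2]
  refine integral_mono_of_nonneg (Eventually.of_forall fun _ => norm_nonneg _) (i1.add i2)
    (Eventually.of_forall fun z => ?_)
  have e : ‖density f z - density g z‖ = |‖f z‖ - ‖g z‖| * (‖f z‖ + ‖g z‖) := by
    rw [density, density, ← Complex.ofReal_sub, Complex.norm_real, Real.norm_eq_abs, sq_sub_sq,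
      abs_mul, abs_of_nonneg (a := ‖f z‖ + ‖g z‖) (by positivity), mul_comm]
  change ‖density f z - density g z‖ ≤ ‖f z - g z‖ * ‖f z‖ + ‖f z - g z‖ * ‖g z‖
  rw [e, ← mul_add]
  gcongr
  exact abs_norm_sub_norm_le _ _

/-- The brackets satisfy `[f̄, f] - [ḡ, g] = [conj (f - g), f] - [f - g, ḡ]`. The difference stands
in the first slot both times, the one that loses its derivative in `conv_poisson`. -/
theorem norm_phase_sub_le {Γ : Space d → ℝ} (hΓ : RegularPotential Γ) (z : PhaseSpace d) :
    ‖phase Γ f z - phase Γ g z‖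
      ≤ potConst Γ * (√(massSq fun z => f z - g z) * (√(vGradSq f) + √(vGradSq g))) := by
  have hs := hf.sub hg
  have hkc : Continuous Γ := hΓ.contDiff.continuous
  have hcp : ∀ {p q : PhaseSpace d → ℂ} (x : Space d), IsC1Compact p → IsC1Compact q →
      Integrable fun y : PhaseSpace d => Γ (x - y.1) • poisson p q y := fun x hp hq => by
    have := hp.continuous_poisson hq
    exact integrable_of_eq_zero_off (by fun_prop) (hp.hasCompactSupport_poisson (g := _))
      fun z hz => by rw [image_eq_zero_of_notMem_tsupport hz, smul_zero]
  have e : phase Γ f z - phase Γ g z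
      = conv Γ (poisson (fun z => conj (f z - g z)) f) z.1
        - conv Γ (poisson (fun z => f z - g z) (fun z => conj (g z))) z.1 := by
    rw [phase, phase, conv, conv, conv, conv, selfBracket, selfBracket,
      ← integral_sub (hcp _ hf.conj_isC1Compact hf) (hcp _ hg.conj_isC1Compact hg),
      ← integral_sub (hcp _ hs.conj_isC1Compact hf) (hcp _ hs hg.conj_isC1Compact)]
    congr 1
    ext y
    rw [← smul_sub, ← smul_sub]
    congr 1
    simp only [poisson, hs.fderiv_conj]
    simp only [hf.fderiv_conj, hg.fderiv_conj, hf.fderiv_sub hg, map_sub,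
      ← Finset.sum_sub_distrib]
    exact Finset.sum_congr rfl fun i _ => by ring
  rw [e]
  have b1 := norm_conv_poisson_le hΓ hs.conj_isC1Compact hf z.1
  have b2 := norm_conv_poisson_le hΓ hs hg.conj_isC1Compact z.1
  simp only [RCLike.norm_conj, hg.vGrad_conj] at b1 b2
  have b3 := hs.integral_norm_mul_vGrad_le hf
  have b4 := hs.integral_norm_mul_vGrad_le hg
  have hC := hΓ.potConst_nonneg
  refine (norm_sub_le _ _).trans ?_
  rw [mul_add, mul_add]
  exact add_le_add (b1.trans (mul_le_mul_of_nonneg_left b3 hC))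
    (b2.trans (mul_le_mul_of_nonneg_left b4 hC))

omit hf hg in
/-- The source term in the equation for the difference of two solutions. -/
noncomputable def differenceSource (Γ : Space d → ℝ) (f g : PhaseSpace d → ℂ) (z : PhaseSpace d) :
    ℂ :=
  ∑ k, ((drift Γ f k z - drift Γ g k z : ℝ) : ℂ) *
      ((fderiv ℝ f z (phaseDir k) + fderiv ℝ g z (phaseDir k)) / 2)
    - (phase Γ f z - phase Γ g z) * ((f z + g z) / 2)

/-- The position components `-v` agree for both fields, so only velocity gradients enter. The
difference of the forces is controlled by `√δ` times the root masses and multiplies velocity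
gradients; the difference of the phases is controlled by `√δ` times the velocity gradient norms and
multiplies the functions. Cauchy-Schwarz brings both to the same product, hence the factor 2. -/
theorem integral_difference_source_le {Γ : Space d → ℝ} (hΓ : RegularPotential Γ) :
    ∫ z, 2 * (conj (f z - g z) * differenceSource Γ f g z).re
      ≤ 2 * potConst Γ * ((√(massSq f) + √(massSq g)) * (√(vGradSq f) + √(vGradSq g)))
        * massSq (fun z => f z - g z) := by
  have hs := hf.sub hg
  have c1 := hf.continuous
  have c2 := hg.continuous
  have c3 := hf.continuous_vGrad
  have c4 := hg.continuous_vGrad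
  have hC := hΓ.potConst_nonneg
  set C := potConst Γ
  set δ := massSq fun z => f z - g z
  set A := √(massSq f) + √(massSq g)
  set D := √(vGradSq f) + √(vGradSq g)
  have hρ := integral_norm_density_sub_le hf hg
  have i1 : ∀ {p : PhaseSpace d → ℝ}, Continuous p → Integrable fun z => ‖f z - g z‖ * p z :=
    fun hp => hs.integrable_mul (by fun_prop) hp fun _ => norm_eq_zero_of_notMem_tsupport
  have pw : ∀ z, 2 * (conj (f z - g z) * differenceSource Γ f g z).re
      ≤ (C * (√δ * A)) * (‖f z - g z‖ * vGrad f z + ‖f z - g z‖ * vGrad g z)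
        + (C * (√δ * D)) * (‖f z - g z‖ * ‖f z‖ + ‖f z - g z‖ * ‖g z‖) := by
    intro z
    have e : 2 * differenceSource Γ f g z
        = ∑ j, conv (partialDeriv Γ j) (fun z => density f z - density g z) z.1
              * fderiv ℝ f z (dirV j)
          + ∑ j, conv (partialDeriv Γ j) (fun z => density f z - density g z) z.1
              * fderiv ℝ g z (dirV j)
          - (phase Γ f z - phase Γ g z) * (f z + g z) := by
      rw [differenceSource, mul_sub, Finset.mul_sum, Fintype.sum_sum_type]
      congr 1
      · have h0 : ∀ j, ((drift Γ f (Sum.inl j) z - drift Γ g (Sum.inl j) z : ℝ) : ℂ) = 0 :=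
          fun j => by simp [drift]
        rw [← Finset.sum_add_distrib, ← Finset.sum_add_distrib]
        refine Finset.sum_congr rfl fun j _ => ?_
        rw [h0, zero_mul, mul_zero, zero_add]
        simp only [drift, Sum.elim_inr, phaseDir, Complex.ofReal_sub, ofReal_re_conv_density]
        rw [conv_density_sub hf hg (hΓ.continuous_partialDeriv j)]
        ring
      · ring
    have b0 : ∀ h : PhaseSpace d → ℂ,
        ‖∑ j, conv (partialDeriv Γ j) (fun z => density f z - density g z) z.1
          * fderiv ℝ h z (dirV j)‖ ≤ C * (√δ * A) * vGrad h z := fun h => by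
      refine (norm_sum_conv_partialDeriv_mul_le hΓ
        (hf.continuous_density.sub hg.continuous_density)
        (hf.hasCompactSupport_density.sub hg.hasCompactSupport_density) z.1 _).trans ?_
      change C * vGrad h z * _ ≤ _
      rw [mul_right_comm]
      gcongr
      · exact Real.sqrt_nonneg _
      · exact hρ
    have b1 := norm_phase_sub_le hf hg hΓ z
    have b2 : ‖2 * differenceSource Γ f g z‖ ≤ C * (√δ * A) * (vGrad f z + vGrad g z)
        + C * (√δ * D) * (‖f z‖ + ‖g z‖) := by
      rw [e, mul_add (C * (√δ * A))]
      refine (norm_sub_le _ _).trans (add_le_add ((norm_add_le _ _).trans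
        (add_le_add (b0 f) (b0 g))) ?_)
      rw [norm_mul]
      exact mul_le_mul b1 (norm_add_le _ _) (norm_nonneg _) (by positivity)
    have b3 : 2 * (conj (f z - g z) * differenceSource Γ f g z).re
        ≤ ‖f z - g z‖ * ‖2 * differenceSource Γ f g z‖ := by
      have h := Complex.re_le_norm (conj (f z - g z) * (2 * differenceSource Γ f g z))
      rw [norm_mul, RCLike.norm_conj] at h
      refine (le_of_eq ?_).trans h
      rw [mul_left_comm]
      simp
    have b4 := mul_le_mul_of_nonneg_left b2 (norm_nonneg (f z - g z))
    linarith
  have iL : Integrable fun z => 2 * (conj (f z - g z) * differenceSource Γ f g z).re := by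
    have c5 := fun w => hf.continuous_deriv w
    have c6 := fun w => hg.continuous_deriv w
    have c7 := fun k => continuous_drift hf hΓ k
    have c8 := fun k => continuous_drift hg hΓ k
    have c9 := continuous_phase hf hΓ
    have c10 := continuous_phase hg hΓ
    refine integrable_of_eq_zero_off ?_ hs.isCompact fun z hz => ?_
    · unfold differenceSource
      fun_prop
    · rw [image_eq_zero_of_notMem_tsupport (f := fun z => f z - g z) hz]
      simp
  refine (integral_mono iL ((((i1 c3).add (i1 c4)).const_mul _).add
    (((i1 c1.norm).add (i1 c2.norm)).const_mul _)) pw).trans ?_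
  rw [integral_add' (((i1 c3).add (i1 c4)).const_mul _) (((i1 c1.norm).add (i1 c2.norm)).const_mul _),
    integral_const_mul, integral_const_mul, integral_add' (i1 c3) (i1 c4),
    integral_add' (i1 c1.norm) (i1 c2.norm)]
  have d1 := add_le_add (hs.integral_norm_mul_vGrad_le hf) (hs.integral_norm_mul_vGrad_le hg)
  have d2 := add_le_add (hs.integral_norm_mul_norm_le hf) (hs.integral_norm_mul_norm_le hg)
  rw [← mul_add] at d1 d2
  have d3 : 0 ≤ C * (√δ * A) := by positivity
  have d4 : 0 ≤ C * (√δ * D) := by positivity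
  refine (add_le_add (mul_le_mul_of_nonneg_left d1 d3) (mul_le_mul_of_nonneg_left d2 d4)).trans_eq ?_
  change C * (√δ * A) * (√δ * D) + C * (√δ * D) * (√δ * A) = _
  have d5 := Real.mul_self_sqrt (massSq_nonneg fun z => f z - g z)
  calc _ = 2 * C * (A * D) * (√δ * √δ) := by ring
    _ = _ := by rw [d5]

end Difference

/-! ### Classical solutions -/

/-- A classical solution, extended to negative times as a continuous family of `C¹` functions. -/
structure IsFlow (Γ : Space d → ℝ) (a : ℝ → PhaseSpace d → ℂ) : Prop where
  continuous : Continuous fun p : ℝ × PhaseSpace d => a p.1 p.2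
  contDiff : ∀ t, ContDiff ℝ 1 (a t)
  continuous_fderiv : Continuous fun p : ℝ × PhaseSpace d => fderiv ℝ (a p.1) p.2
  support : ∀ T : ℝ, ∃ K : Set (PhaseSpace d), IsCompact K ∧ ∀ t ≤ T, ∀ z, z ∉ K → a t z = 0
  deriv : ∀ t, 0 ≤ t → ∀ z, HasDerivWithinAt (fun s => a s z) (hvlRhs Γ (a t) z) (Ioi t) t

theorem continuous_integral_of_support {g : ℝ → PhaseSpace d → ℝ}
    (hg : Continuous fun p : ℝ × PhaseSpace d => g p.1 p.2)
    (hs : ∀ T : ℝ, ∃ K : Set (PhaseSpace d), IsCompact K ∧ ∀ t ≤ T, ∀ z, z ∉ K → g t z = 0) :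
    Continuous fun t => ∫ z, g t z := by
  rw [continuous_iff_continuousAt]
  intro t₀
  obtain ⟨K, hK, h0⟩ := hs (t₀ + 1)
  have h1 : Continuous (fun t => ∫ z in K, g t z) :=
    continuous_parametric_integral_of_continuous hg hK
  refine h1.continuousAt.congr ?_
  filter_upwards [Iio_mem_nhds (lt_add_one t₀)] with t ht
  exact setIntegral_eq_integral_of_eq_zero_off (h0 t (le_of_lt ht))

theorem IsClassicalSolution.exists_isFlow {Γ : Space d → ℝ} {u : ℝ → L2 d}
    (hu : IsClassicalSolution Γ u) :
    ∃ a, IsFlow Γ a ∧ ∀ t, 0 ≤ t → u t =ᵐ[volume] a t := by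
  obtain ⟨a, hua, hcd, hsupp, hder⟩ := hu
  set S : Set (ℝ × PhaseSpace d) := Ici 0 ×ˢ univ
  have hUD : UniqueDiffOn ℝ S := (uniqueDiffOn_Ici 0).prod uniqueDiffOn_univ
  have hmap : Continuous (fun p : ℝ × PhaseSpace d => ((max p.1 0, p.2) : ℝ × PhaseSpace d)) := by
    fun_prop
  have hmem : ∀ p : ℝ × PhaseSpace d, ((max p.1 0, p.2) : ℝ × PhaseSpace d) ∈ S := fun p =>
    ⟨mem_Ici.2 (le_max_right p.1 0), mem_univ _⟩
  have hcda : ∀ t, 0 ≤ t → ContDiff ℝ 1 (a t) := fun t ht =>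
    contDiffOn_univ.1 (hcd.comp (g := fun p : ℝ × PhaseSpace d => a p.1 p.2)
      (f := fun z => (t, z)) (by fun_prop) fun z _ => ⟨ht, mem_univ _⟩)
  -- The spatial derivative is the joint derivative within the half-space, restricted to spatial
  -- directions; this yields its joint continuity in time and space.
  have hfd : ∀ t, 0 ≤ t → ∀ z, fderiv ℝ (a t) z
      = (fderivWithin ℝ (fun p : ℝ × PhaseSpace d => a p.1 p.2) S (t, z)).comp
        (ContinuousLinearMap.inr ℝ ℝ (PhaseSpace d)) := fun t ht z => by
    have h1 := (hcd.differentiableOn (by norm_num) (t, z) ⟨ht, mem_univ _⟩).hasFDerivWithinAt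
    have h2 : HasFDerivWithinAt (fun z : PhaseSpace d => (t, z))
        (ContinuousLinearMap.inr ℝ ℝ (PhaseSpace d)) univ z :=
      (hasFDerivAt_prodMk_right t z).hasFDerivWithinAt
    exact (hasFDerivWithinAt_univ.1
      (h1.comp z h2 fun y _ => ⟨ht, mem_univ _⟩)).fderiv
  -- The initial value is frozen for negative times. Joint continuity then holds on the whole line,
  -- and the equation is needed only as a right derivative at `t ≥ 0`.
  refine ⟨fun t => a (max t 0), ⟨?_, fun t => hcda _ (le_max_right _ _), ?_, fun T => ?_, ?_⟩, ?_⟩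
  · exact hcd.continuousOn.comp_continuous hmap hmem
  · have h1 := (hcd.continuousOn_fderivWithin hUD (by norm_num)).comp_continuous hmap hmem
    simp only [hfd _ (le_max_right _ _)]
    exact h1.clm_comp continuous_const
  · obtain ⟨K, hK, h0⟩ := hsupp (max T 0)
    exact ⟨K, hK, fun t ht z hz => h0 _ ⟨le_max_right _ _, max_le_max_right _ ht⟩ z hz⟩
  · intro t ht z
    have h1 := (hder t ht z).mono (Ioi_subset_Ici ht)
    simp only [max_eq_left ht]
    refine h1.congr (fun s hs => ?_) ?_
    · rw [max_eq_left (ht.trans (le_of_lt hs))]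
    · rw [max_eq_left ht]
  · intro t ht
    simp only [max_eq_left ht]
    exact hua t ht

/-! ### Mass, gradient growth and stability along classical solutions -/

namespace IsFlow

variable {Γ : Space d → ℝ} {a b : ℝ → PhaseSpace d → ℂ} (ha : IsFlow Γ a) (hb : IsFlow Γ b)
  (hΓ : RegularPotential Γ)
include ha

theorem isC1Compact (t : ℝ) : IsC1Compact (a t) := by
  obtain ⟨K, hK, h0⟩ := ha.support t
  exact ⟨ha.contDiff t, HasCompactSupport.intro hK (h0 t le_rfl)⟩

theorem continuous_deriv (w : PhaseSpace d) :
    Continuous fun p : ℝ × PhaseSpace d => fderiv ℝ (a p.1) p.2 w :=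
  ha.continuous_fderiv.clm_apply continuous_const

theorem support_deriv (T : ℝ) : ∃ K : Set (PhaseSpace d), IsCompact K ∧ ∀ t ≤ T, ∀ z, z ∉ K →
    a t z = 0 ∧ ∀ w, fderiv ℝ (a t) z w = 0 := by
  obtain ⟨K, hK, h0⟩ := ha.support T
  exact ⟨K, hK, fun t ht z hz => ⟨h0 t ht z hz, fun w => lineDeriv_eq_zero_of_notMem hK.isClosed
    (h0 t ht) hz ((ha.isC1Compact t).hasLineDerivAt w z)⟩⟩

theorem continuous_conv_density {k : Space d → ℝ} (hk : Continuous k) :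
    Continuous fun p : ℝ × PhaseSpace d => conv k (density (a p.1)) p.2.1 := by
  have h := continuous_conv hk (f := fun t => density (a t))
    (by have := ha.continuous; unfold density; fun_prop) fun T => by
      obtain ⟨K, hK, h0⟩ := ha.support T
      exact ⟨K, hK, fun t ht z hz => by simp [density, h0 t ht z hz]⟩
  exact h.comp (f := fun p : ℝ × PhaseSpace d => (p.1, p.2.1)) (by fun_prop)

theorem continuous_conv_selfBracket {k : Space d → ℝ} (hk : Continuous k) :
    Continuous fun p : ℝ × PhaseSpace d => conv k (selfBracket (a p.1)) p.2.1 := by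
  have h := continuous_conv hk (f := fun t => selfBracket (a t))
    (by
      have := fun w => ha.continuous_deriv w
      simp only [selfBracket, poisson, (ha.isC1Compact _).fderiv_conj]
      fun_prop) fun T => by
      obtain ⟨K, hK, h0⟩ := ha.support_deriv T
      exact ⟨K, hK, fun t ht z hz => by simp [selfBracket, poisson, (h0 t ht z hz).2]⟩
  exact h.comp (f := fun p : ℝ × PhaseSpace d => (p.1, p.2.1)) (by fun_prop)

include hΓ

theorem continuous_drift (k : Fin d ⊕ Fin d) :
    Continuous fun p : ℝ × PhaseSpace d => drift Γ (a p.1) k p.2 := by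
  rcases k with j | j
  · simp only [drift, Sum.elim_inl]
    fun_prop
  · exact Complex.continuous_re.comp (ha.continuous_conv_density (hΓ.continuous_partialDeriv j))

theorem continuous_driftDeriv (w k : Fin d ⊕ Fin d) :
    Continuous fun p : ℝ × PhaseSpace d => driftDeriv Γ (a p.1) w k p.2 := by
  rcases w with i | i <;> rcases k with j | j
  · exact continuous_const
  · exact Complex.continuous_re.comp (ha.continuous_conv_density (hΓ.continuous_partialDeriv₂ j i))
  · exact continuous_const
  · exact continuous_const

theorem continuous_phase : Continuous fun p : ℝ × PhaseSpace d => phase Γ (a p.1) p.2 :=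
  ha.continuous_conv_selfBracket hΓ.contDiff.continuous

theorem continuous_phaseDeriv (w : Fin d ⊕ Fin d) :
    Continuous fun p : ℝ × PhaseSpace d => phaseDeriv Γ (a p.1) w p.2 := by
  rcases w with i | i
  · exact ha.continuous_conv_selfBracket (hΓ.continuous_partialDeriv i)
  · exact continuous_const

theorem hasLineDerivAt_drift_self (k : Fin d ⊕ Fin d) (t : ℝ) (z : PhaseSpace d) :
    HasLineDerivAt ℝ (drift Γ (a t) k) 0 z (phaseDir k) := by
  simpa [driftDeriv_self] using hasLineDerivAt_drift (ha.isC1Compact t) hΓ k k z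

theorem massSq_eq {t : ℝ} (ht : 0 ≤ t) : massSq (a t) = massSq (a 0) := by
  obtain ⟨K, hK, h0⟩ := ha.support t
  have h := integral_normSq_sub_eq_source (μ := (volume : Measure (PhaseSpace d))) (e := phaseDir)
    (F := a) (S := fun _ _ => 0) (F' := fun k t z => fderiv ℝ (a t) z (phaseDir k))
    (B := fun k t => drift Γ (a t) k) (Φ := fun t => phase Γ (a t)) ha.continuous
    (fun k => ha.continuous_deriv _) (fun k t z => (ha.isC1Compact t).hasLineDerivAt _ z)
    (ha.continuous_drift hΓ) (ha.hasLineDerivAt_drift_self hΓ) (ha.continuous_phase hΓ)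
    (fun t z => phase_re (ha.isC1Compact t) Γ z) continuous_const ht
    (fun s hs z => by
      rw [add_zero, ← hvlRhs_eq (ha.isC1Compact s) hΓ]
      exact ha.deriv s hs.1.le z) hK (fun s hs => h0 s hs.2)
  simp only [mul_zero, Complex.zero_re, integral_zero, intervalIntegral.integral_zero] at h
  exact sub_eq_zero.1 h

/-- The energy identities of all coordinate directions are added before estimating, because the
sources couple position and velocity derivatives. Conservation of mass makes the rate constant in
time, and Grönwall applies. -/
theorem gradSq_le {t : ℝ} (ht : 0 ≤ t) : xGradSq (a t) + vGradSq (a t)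
    ≤ (xGradSq (a 0) + vGradSq (a 0)) * Real.exp ((1 + 2 * potConst Γ * massSq (a 0)) * t) := by
  have hC := hΓ.potConst_nonneg
  have hm := massSq_nonneg (a 0)
  have esum : ∀ t, xGradSq (a t) + vGradSq (a t)
      = ∑ w, ∫ z, ‖fderiv ℝ (a t) z (phaseDir w)‖ ^ 2 := fun t => by
    rw [Fintype.sum_sum_type, (ha.isC1Compact t).xGradSq_eq, (ha.isC1Compact t).vGradSq_eq]
    rfl
  have cy : Continuous fun t => xGradSq (a t) + vGradSq (a t) := by
    simp only [esum]
    refine continuous_finsetSum _ fun w _ => continuous_integral_of_support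
      (g := fun t z => ‖fderiv ℝ (a t) z (phaseDir w)‖ ^ 2) ?_ fun T => ?_
    · have := ha.continuous_deriv (phaseDir w)
      fun_prop
    · obtain ⟨K, hK, h0⟩ := ha.support_deriv T
      exact ⟨K, hK, fun t ht z hz => by simp [(h0 t ht z hz).2]⟩
  have hi : ∀ w, Continuous fun t => ∫ z, 2 * (conj (fderiv ℝ (a t) z (phaseDir w)) *
      (∑ k, driftDeriv Γ (a t) w k z * fderiv ℝ (a t) z (phaseDir k)
        - phaseDeriv Γ (a t) w z * a t z)).re := fun w => by
    refine continuous_integral_of_support (g := fun t z =>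
      2 * (conj (fderiv ℝ (a t) z (phaseDir w)) *
      (∑ k, driftDeriv Γ (a t) w k z * fderiv ℝ (a t) z (phaseDir k)
        - phaseDeriv Γ (a t) w z * a t z)).re) ?_ fun T => ?_
    · have c1 := fun k => ha.continuous_deriv (phaseDir k)
      have c2 := ha.continuous_driftDeriv hΓ w
      have c3 := ha.continuous_phaseDeriv hΓ w
      have c4 := ha.continuous
      fun_prop
    · obtain ⟨K, hK, h0⟩ := ha.support_deriv T
      exact ⟨K, hK, fun t ht z hz => by simp [(h0 t ht z hz).2]⟩
  have h := gronwall_integral cy (κ := fun _ => 1 + 2 * potConst Γ * massSq (a 0))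
    (y₀ := xGradSq (a 0) + vGradSq (a 0)) continuous_const (fun _ => by positivity)
    (fun t ht => by
      obtain ⟨K, hK, h0⟩ := ha.support t
      have h := fun w => integral_normSq_lineDeriv_sub_eq
        (μ := (volume : Measure (PhaseSpace d))) (e := phaseDir) (w := phaseDir w)
        (a := a) (a' := fun k t z => fderiv ℝ (a t) z (phaseDir k))
        (aw := fun t z => fderiv ℝ (a t) z (phaseDir w))
        (B := fun k t => drift Γ (a t) k) (Bw := fun k t => driftDeriv Γ (a t) w k)
        (Φ := fun t => phase Γ (a t)) (Φw := fun t => phaseDeriv Γ (a t) w) ha.continuous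
        (fun k => ha.continuous_deriv _) (ha.continuous_deriv _)
        (fun k t z => (ha.isC1Compact t).hasLineDerivAt _ z)
        (fun t z => (ha.isC1Compact t).hasLineDerivAt _ z)
        (ha.continuous_drift hΓ) (ha.continuous_driftDeriv hΓ w)
        (ha.hasLineDerivAt_drift_self hΓ)
        (fun k t z => hasLineDerivAt_drift (ha.isC1Compact t) hΓ w k z)
        (ha.continuous_phase hΓ) (ha.continuous_phaseDeriv hΓ w)
        (fun t z => phase_re (ha.isC1Compact t) Γ z)
        (fun t z => hasLineDerivAt_phase (ha.isC1Compact t) hΓ w z) ht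
        (fun s hs z => by
          rw [← hvlRhs_eq (ha.isC1Compact s) hΓ]
          exact ha.deriv s hs.1.le z) hK (fun s hs => h0 s hs.2)
      have h2 := Finset.sum_congr (rfl : (Finset.univ : Finset (Fin d ⊕ Fin d)) = Finset.univ)
        fun w _ => h w
      rw [Finset.sum_sub_distrib, ← esum, ← esum,
        ← intervalIntegral.integral_finsetSum fun w _ => (hi w).intervalIntegrable _ _] at h2
      rw [sub_eq_iff_eq_add'.1 h2]
      gcongr
      refine intervalIntegral.integral_mono_on ht
        ((continuous_finsetSum _ fun w _ => hi w).intervalIntegrable _ _)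
        ((cy.const_mul _).intervalIntegrable _ _) fun s hs => ?_
      rw [← ha.massSq_eq hΓ hs.1]
      exact integral_gradient_source_le (ha.isC1Compact s) hΓ) ht
  rwa [intervalIntegral.integral_const, sub_zero, smul_eq_mul, mul_comm t] at h

include hb

theorem massSq_sub_le {κ : ℝ → ℝ} (hκ : Continuous κ) (hκ0 : ∀ t, 0 ≤ κ t)
    (hle : ∀ t, 0 ≤ t → 2 * potConst Γ * ((√(massSq (a t)) + √(massSq (b t))) *
      (√(vGradSq (a t)) + √(vGradSq (b t)))) ≤ κ t) {t : ℝ} (ht : 0 ≤ t) :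
    massSq (fun z => a t z - b t z)
      ≤ massSq (fun z => a 0 z - b 0 z) * Real.exp (∫ τ in (0 : ℝ)..t, κ τ) := by
  have ca := ha.continuous
  have cb := hb.continuous
  have hsupp : ∀ T : ℝ, ∃ K : Set (PhaseSpace d), IsCompact K ∧ ∀ t ≤ T, ∀ z, z ∉ K →
      a t z - b t z = 0 := fun T => by
    obtain ⟨K, hK, h0⟩ := ha.support T
    obtain ⟨K', hK', h0'⟩ := hb.support T
    refine ⟨K ∪ K', hK.union hK', fun t ht z hz => ?_⟩
    rw [h0 t ht z fun h => hz (Or.inl h), h0' t ht z fun h => hz (Or.inr h), sub_zero]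
  have cy : Continuous fun t => massSq fun z => a t z - b t z := by
    refine continuous_integral_of_support (g := fun t z => ‖a t z - b t z‖ ^ 2) (by fun_prop)
      fun T => ?_
    obtain ⟨K, hK, h0⟩ := hsupp T
    exact ⟨K, hK, fun t ht z hz => by simp [h0 t ht z hz]⟩
  have cS : Continuous fun p : ℝ × PhaseSpace d => differenceSource Γ (a p.1) (b p.1) p.2 := by
    have c1 := fun k => ha.continuous_deriv (phaseDir k)
    have c2 := fun k => hb.continuous_deriv (phaseDir k)
    have c3 := fun k => ha.continuous_drift hΓ k
    have c4 := fun k => hb.continuous_drift hΓ k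
    have c5 := ha.continuous_phase hΓ
    have c6 := hb.continuous_phase hΓ
    unfold differenceSource
    fun_prop
  refine gronwall_integral cy hκ hκ0 (fun t ht => ?_) ht
  obtain ⟨K, hK, h0⟩ := hsupp t
  -- The splitting is `pp' - qq' = ½(p + q)(p' - q') + ½(p - q)(p' + q')`. The averaged field and
  -- potential are again divergence free and imaginary, so they drop out, and what is left is
  -- `differenceSource`.
  have h := integral_normSq_sub_eq_source (μ := (volume : Measure (PhaseSpace d))) (e := phaseDir)
    (F := fun t z => a t z - b t z) (S := fun t => differenceSource Γ (a t) (b t))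
    (F' := fun k t z => fderiv ℝ (a t) z (phaseDir k) - fderiv ℝ (b t) z (phaseDir k))
    (B := fun k t z => (2 : ℝ)⁻¹ * (drift Γ (a t) k z + drift Γ (b t) k z))
    (Φ := fun t z => (2 : ℝ)⁻¹ * (phase Γ (a t) z + phase Γ (b t) z)) (by fun_prop)
    (fun k => (ha.continuous_deriv _).sub (hb.continuous_deriv _))
    (fun k t z => HasLineDerivAt.sub' ((ha.isC1Compact t).hasLineDerivAt _ z)
      ((hb.isC1Compact t).hasLineDerivAt _ z))
    (fun k => ((ha.continuous_drift hΓ k).add (hb.continuous_drift hΓ k)).const_mul _)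
    (fun k t z => by
      have h1 := ha.hasLineDerivAt_drift_self hΓ k t z
      have h2 := hb.hasLineDerivAt_drift_self hΓ k t z
      unfold HasLineDerivAt at h1 h2 ⊢
      simpa using (h1.add h2).const_mul (2 : ℝ)⁻¹)
    (((ha.continuous_phase hΓ).add (hb.continuous_phase hΓ)).const_mul _)
    (fun t z => by
      simp [phase_re (ha.isC1Compact t), phase_re (hb.isC1Compact t)])
    cS ht
    (fun s hs z => by
      have h := (ha.deriv s hs.1.le z).sub (hb.deriv s hs.1.le z)
      refine h.congr_deriv ?_
      rw [hvlRhs_eq (ha.isC1Compact s) hΓ, hvlRhs_eq (hb.isC1Compact s) hΓ, differenceSource]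
      have e : ∀ k, (drift Γ (a s) k z : ℂ) * fderiv ℝ (a s) z (phaseDir k)
          = (((2 : ℝ)⁻¹ * (drift Γ (a s) k z + drift Γ (b s) k z) : ℝ) : ℂ) *
              (fderiv ℝ (a s) z (phaseDir k) - fderiv ℝ (b s) z (phaseDir k))
            + ((drift Γ (a s) k z - drift Γ (b s) k z : ℝ) : ℂ) *
              ((fderiv ℝ (a s) z (phaseDir k) + fderiv ℝ (b s) z (phaseDir k)) / 2)
            + (drift Γ (b s) k z : ℂ) * fderiv ℝ (b s) z (phaseDir k) := fun k => by
        push_cast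
        ring
      simp only [e, Finset.sum_add_distrib]
      push_cast
      ring) hK (fun s hs => h0 s hs.2)
  change massSq (fun z => a t z - b t z) - massSq (fun z => a 0 z - b 0 z) = _ at h
  rw [sub_eq_iff_eq_add'.1 h]
  gcongr
  refine intervalIntegral.integral_mono_on ht (Continuous.intervalIntegrable ?_ _ _)
    ((hκ.mul cy).intervalIntegrable _ _) fun s hs => ?_
  · refine continuous_integral_of_support (g := fun t z =>
      2 * (conj (a t z - b t z) * differenceSource Γ (a t) (b t) z).re)
      ((Complex.continuous_re.comp
        ((Complex.continuous_conj.comp (ca.sub cb)).mul cS)).const_mul 2) fun T => ?_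
    obtain ⟨K, hK, h0⟩ := hsupp T
    exact ⟨K, hK, fun t ht z hz => by simp [h0 t ht z hz]⟩
  · refine (integral_difference_source_le (ha.isC1Compact s) (hb.isC1Compact s) hΓ).trans ?_
    exact mul_le_mul_of_nonneg_right (hle s hs.1) (massSq_nonneg _)

end IsFlow

end HamiltonVlasov

namespace HamiltonVlasov

variable {d : ℕ}

/-! ### Weak derivatives -/

/-- Pairing with a test function is an inner product in `L²`. The definition of the weak derivative
thereby becomes an identity of continuous functionals, which is linear and stable under weak limits.
-/
theorem exists_inner_eq_integral_smul {ψ : PhaseSpace d → ℝ} (hψ : Continuous ψ)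
    (hψ0 : HasCompactSupport ψ) : ∃ p : L2 d, ∀ u : L2 d, ∫ z, ψ z • u z = inner ℂ p u := by
  have hψc : Continuous fun z => (ψ z : ℂ) := by fun_prop
  have hm : MemLp (fun z => (ψ z : ℂ)) 2 (volume : Measure (PhaseSpace d)) :=
    hψc.memLp_of_hasCompactSupport (hψ0.comp_left (g := fun r : ℝ => (r : ℂ)) Complex.ofReal_zero)
  refine ⟨hm.toLp, fun u => ?_⟩
  rw [L2.inner_def]
  refine integral_congr_ae ?_
  filter_upwards [hm.coeFn_toLp] with z hz
  rw [hz]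
  simp [mul_comm]

theorem hasCompactSupport_fderiv_apply {φ : PhaseSpace d → ℝ} (hφ0 : HasCompactSupport φ)
    (w : PhaseSpace d) : HasCompactSupport fun z => fderiv ℝ φ z w :=
  (hφ0.fderiv (𝕜 := ℝ)).comp_left (g := fun L : PhaseSpace d →L[ℝ] ℝ => L w) rfl

theorem IsWeakDeriv.unique {w : PhaseSpace d} {u g h : L2 d} (hg : IsWeakDeriv w u g)
    (hh : IsWeakDeriv w u h) : g = h := by
  rw [← sub_eq_zero]
  have hl : LocallyIntegrable (fun z => (g - h : L2 d) z) (volume : Measure (PhaseSpace d)) :=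
    (Lp.memLp (g - h)).locallyIntegrable (by norm_num)
  have h0 := ae_eq_zero_of_integral_contDiff_smul_eq_zero hl fun φ hφ hφ0 => by
    obtain ⟨p, hp⟩ := exists_inner_eq_integral_smul hφ.continuous hφ0
    have e1 := hg φ hφ hφ0
    have e2 := hh φ hφ hφ0
    rw [e1, hp, hp, neg_inj] at e2
    rw [hp, inner_sub_right, e2, sub_self]
  exact (Lp.eq_zero_iff_ae_eq_zero).2 h0

theorem IsWeakDeriv.weakDeriv_eq {w : PhaseSpace d} {u g : L2 d} (hg : IsWeakDeriv w u g) :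
    weakDeriv w u = g := by
  have h : ∃ g, IsWeakDeriv w u g := ⟨g, hg⟩
  rw [weakDeriv, dif_pos h]
  exact h.choose_spec.unique hg

theorem isWeakDeriv_weakDeriv {w : PhaseSpace d} {u : L2 d} (h : ∃ g, IsWeakDeriv w u g) :
    IsWeakDeriv w u (weakDeriv w u) := by
  rw [weakDeriv, dif_pos h]
  exact h.choose_spec

theorem IsWeakDeriv.sub {w : PhaseSpace d} {u v g h : L2 d} (hg : IsWeakDeriv w u g)
    (hh : IsWeakDeriv w v h) : IsWeakDeriv w (u - v) (g - h) := by
  intro φ hφ hφ0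
  have c : Continuous fun z => fderiv ℝ φ z w :=
    (hφ.continuous_fderiv (by simp)).clm_apply continuous_const
  obtain ⟨p, hp⟩ := exists_inner_eq_integral_smul hφ.continuous hφ0
  obtain ⟨q, hq⟩ := exists_inner_eq_integral_smul c (hasCompactSupport_fderiv_apply hφ0 w)
  have e1 := hg φ hφ hφ0
  have e2 := hh φ hφ hφ0
  rw [hp, hq] at e1 e2 ⊢
  rw [inner_sub_right, inner_sub_right, e1, e2]
  ring

theorem IsC1Compact.memLp_deriv {f : PhaseSpace d → ℂ} (hf : IsC1Compact f) (w : PhaseSpace d) :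
    MemLp (fun z => fderiv ℝ f z w) 2 (volume : Measure (PhaseSpace d)) :=
  (hf.continuous_deriv w).memLp_of_hasCompactSupport
    (HasCompactSupport.intro hf.isCompact fun _ hz => hf.deriv_eq_zero hz w)

theorem IsC1Compact.isWeakDeriv {f : PhaseSpace d → ℂ} (hf : IsC1Compact f) {u : L2 d}
    (hu : u =ᵐ[volume] f) (w : PhaseSpace d) : IsWeakDeriv w u (hf.memLp_deriv w).toLp := by
  intro φ hφ hφ0
  have c0 := hφ.continuous
  have c : Continuous fun z => fderiv ℝ φ z w :=
    (hφ.continuous_fderiv (by simp)).clm_apply continuous_const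
  have c1 := hf.continuous
  have c2 := hf.continuous_deriv w
  have e1 : ∫ z, fderiv ℝ φ z w • u z = ∫ z, (fderiv ℝ φ z w : ℂ) * f z := by
    refine integral_congr_ae ?_
    filter_upwards [hu] with z hz
    rw [hz, Complex.real_smul]
  have e2 : ∫ z, φ z • ((hf.memLp_deriv w).toLp : L2 d) z = ∫ z, (φ z : ℂ) * fderiv ℝ f z w := by
    refine integral_congr_ae ?_
    filter_upwards [(hf.memLp_deriv w).coeFn_toLp] with z hz
    rw [hz, Complex.real_smul]
  have h := integral_lineDeriv_eq_zero (μ := (volume : Measure (PhaseSpace d))) (w := w)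
    (F := fun z => (φ z : ℂ) * f z)
    (F' := fun z => (fderiv ℝ φ z w : ℂ) * f z + (φ z : ℂ) * fderiv ℝ f z w) (by fun_prop)
    (by fun_prop) hf.isCompact (fun z hz => by simp [image_eq_zero_of_notMem_tsupport hz])
    (fun z => HasLineDerivAt.mul' (HasLineDerivAt.ofReal
      ((hφ.differentiable (by simp) z).hasFDerivAt.hasLineDerivAt w)) (hf.hasLineDerivAt w z))
  rw [integral_add] at h
  · rw [e1, e2]
    exact eq_neg_of_add_eq_zero_left h
  · exact integrable_of_eq_zero_off (by fun_prop) hf.isCompact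
      fun z hz => by simp [image_eq_zero_of_notMem_tsupport hz]
  · exact integrable_of_eq_zero_off (by fun_prop) hf.isCompact
      fun z hz => by simp [hf.deriv_eq_zero hz]

theorem norm_sq_eq_integral {u : L2 d} {f : PhaseSpace d → ℂ} (hu : u =ᵐ[volume] f) :
    ‖u‖ ^ 2 = ∫ z, ‖f z‖ ^ 2 := by
  have h1 : ((‖u‖ ^ 2 : ℝ) : ℂ) = inner ℂ u u := by
    rw [inner_self_eq_norm_sq_to_K]
    simp
  have h2 : (inner ℂ u u : ℂ) = ((∫ z, ‖f z‖ ^ 2 : ℝ) : ℂ) := by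
    rw [L2.inner_def, ← integral_complex_ofReal]
    refine integral_congr_ae ?_
    filter_upwards [hu] with z hz
    rw [hz, inner_self_eq_norm_sq_to_K]
    simp
  exact_mod_cast h1.trans h2

theorem IsC1Compact.norm_weakDeriv_sq {f : PhaseSpace d → ℂ} (hf : IsC1Compact f) {u : L2 d}
    (hu : u =ᵐ[volume] f) (w : PhaseSpace d) :
    ‖weakDeriv w u‖ ^ 2 = ∫ z, ‖fderiv ℝ f z w‖ ^ 2 := by
  rw [(hf.isWeakDeriv hu w).weakDeriv_eq]
  exact norm_sq_eq_integral (hf.memLp_deriv w).coeFn_toLp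

theorem IsC1Compact.memW12 {f : PhaseSpace d → ℂ} (hf : IsC1Compact f) {u : L2 d}
    (hu : u =ᵐ[volume] f) : MemW12 u := fun i =>
  ⟨⟨_, hf.isWeakDeriv hu (dirX i)⟩, ⟨_, hf.isWeakDeriv hu (dirV i)⟩⟩

theorem w12Norm_nonneg (u : L2 d) : 0 ≤ w12Norm u := Real.sqrt_nonneg _

theorem w12Norm_sq (u : L2 d) : w12Norm u ^ 2
    = ‖u‖ ^ 2 + ∑ i, ‖weakDeriv (dirX i) u‖ ^ 2 + ∑ i, ‖weakDeriv (dirV i) u‖ ^ 2 :=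
  Real.sq_sqrt (by positivity)

theorem IsC1Compact.w12Norm_sq_eq {f : PhaseSpace d → ℂ} (hf : IsC1Compact f) {u : L2 d}
    (hu : u =ᵐ[volume] f) : w12Norm u ^ 2 = massSq f + (xGradSq f + vGradSq f) := by
  rw [w12Norm_sq, hf.xGradSq_eq, hf.vGradSq_eq, norm_sq_eq_integral hu, add_assoc]
  simp only [hf.norm_weakDeriv_sq hu]
  rfl

theorem norm_le_w12Norm (u : L2 d) : ‖u‖ ≤ w12Norm u := by
  refine Real.le_sqrt_of_sq_le ?_
  rw [add_assoc]
  exact le_add_of_nonneg_right (by positivity)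

theorem norm_weakDeriv_dirX_le (u : L2 d) (i : Fin d) : ‖weakDeriv (dirX i) u‖ ≤ w12Norm u := by
  refine Real.le_sqrt_of_sq_le ?_
  have h := Finset.single_le_sum (f := fun i => ‖weakDeriv (dirX i) u‖ ^ 2)
    (fun i _ => sq_nonneg _) (Finset.mem_univ i)
  have h2 : 0 ≤ ∑ i, ‖weakDeriv (dirV i) u‖ ^ 2 := by positivity
  nlinarith [sq_nonneg ‖u‖]

theorem norm_weakDeriv_dirV_le (u : L2 d) (i : Fin d) : ‖weakDeriv (dirV i) u‖ ≤ w12Norm u := by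
  refine Real.le_sqrt_of_sq_le ?_
  have h := Finset.single_le_sum (f := fun i => ‖weakDeriv (dirV i) u‖ ^ 2)
    (fun i _ => sq_nonneg _) (Finset.mem_univ i)
  have h2 : 0 ≤ ∑ i, ‖weakDeriv (dirX i) u‖ ^ 2 := by positivity
  nlinarith [sq_nonneg ‖u‖]

/-- The norm of `W^{1,2}` is continuous. -/
theorem tendsto_w12Norm {u : ℕ → L2 d} {v : L2 d} (hu : ∀ n, MemW12 (u n)) (hv : MemW12 v)
    (h : Tendsto (fun n => w12Norm (u n - v)) atTop (𝓝 0)) :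
    Tendsto (fun n => w12Norm (u n)) atTop (𝓝 (w12Norm v)) := by
  have h0 : Tendsto u atTop (𝓝 v) := tendsto_iff_norm_sub_tendsto_zero.2
    (squeeze_zero (fun _ => norm_nonneg _) (fun n => norm_le_w12Norm _) h)
  have hX : ∀ i, Tendsto (fun n => weakDeriv (dirX i) (u n)) atTop (𝓝 (weakDeriv (dirX i) v)) :=
    fun i => tendsto_iff_norm_sub_tendsto_zero.2
      (squeeze_zero (fun _ => norm_nonneg _) (fun n => by
        rw [← ((isWeakDeriv_weakDeriv (hu n i).1).sub (isWeakDeriv_weakDeriv (hv i).1)).weakDeriv_eq]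
        exact norm_weakDeriv_dirX_le _ i) h)
  have hV : ∀ i, Tendsto (fun n => weakDeriv (dirV i) (u n)) atTop (𝓝 (weakDeriv (dirV i) v)) :=
    fun i => tendsto_iff_norm_sub_tendsto_zero.2
      (squeeze_zero (fun _ => norm_nonneg _) (fun n => by
        rw [← ((isWeakDeriv_weakDeriv (hu n i).2).sub (isWeakDeriv_weakDeriv (hv i).2)).weakDeriv_eq]
        exact norm_weakDeriv_dirV_le _ i) h)
  exact ((((h0.norm).pow 2).add (tendsto_finsetSum _ fun i _ => ((hX i).norm).pow 2)).add
    (tendsto_finsetSum _ fun i _ => ((hV i).norm).pow 2)).sqrt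

/-! ### Weak compactness -/

/-- Banach-Alaoglu on the dual, transported by the Riesz isomorphism. Convergence along an
ultrafilter replaces extraction of subsequences. -/
theorem exists_weak_limit {H : Type*} [NormedAddCommGroup H] [InnerProductSpace ℂ H]
    [CompleteSpace H] {R : ℝ} {g : ℕ → H} (hg : ∀ n, ‖g n‖ ≤ R) (U : Ultrafilter ℕ) :
    ∃ g₀ : H, ∀ p, Tendsto (fun n => inner ℂ p (g n)) U (𝓝 (inner ℂ p g₀)) := by
  let T : ℕ → WeakDual ℂ H := fun n => StrongDual.toWeakDual (InnerProductSpace.toDual ℂ H (g n))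
  have hT : ∀ n, T n ∈ WeakDual.toStrongDual ⁻¹' Metric.closedBall (0 : StrongDual ℂ H) R := by
    intro n
    rw [mem_preimage, mem_closedBall_zero_iff]
    exact (LinearIsometryEquiv.norm_map (InnerProductSpace.toDual ℂ H) (g n)).trans_le (hg n)
  obtain ⟨x, -, hx⟩ := (WeakDual.isCompact_closedBall (0 : StrongDual ℂ H) R).ultrafilter_le_nhds'
    (U.map T) (Filter.Eventually.of_forall hT : ∀ᶠ n in (U : Filter ℕ), T n ∈ _)
  refine ⟨(InnerProductSpace.toDual ℂ H).symm (WeakDual.toStrongDual x), fun p => ?_⟩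
  have h1 : Tendsto (fun n => T n p) U (𝓝 (x p)) :=
    (WeakDual.eval_continuous p).continuousAt.tendsto.comp (show Tendsto T U (𝓝 x) from hx)
  have h2 := (Complex.continuous_conj.tendsto _).comp h1
  rw [← inner_conj_symm, InnerProductSpace.toDual_symm_apply]
  refine h2.congr fun n => ?_
  exact inner_conj_symm p (g n)

/-- A weak limit `g` of the derivatives inherits the defining identity. Pairing the sequence with
`g` itself gives `‖g‖² ≤ ‖g‖ r`. Here `r` is the limit of the norms, not merely the bound `R`, so
that the squares can later be added without loss. -/
theorem exists_isWeakDeriv_of_tendsto {w : PhaseSpace d} {u : ℕ → L2 d} {v : L2 d} {R : ℝ}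
    (hu : ∀ n, ∃ g, IsWeakDeriv w (u n) g) (hR : ∀ n, ‖weakDeriv w (u n)‖ ≤ R)
    (U : Ultrafilter ℕ) (h : Tendsto u U (𝓝 v)) :
    ∃ r : ℝ, Tendsto (fun n => ‖weakDeriv w (u n)‖) U (𝓝 r) ∧
      ∃ g, IsWeakDeriv w v g ∧ ‖g‖ ≤ r := by
  obtain ⟨r, -, hr⟩ := (isCompact_Icc (a := (0 : ℝ)) (b := R)).ultrafilter_le_nhds'
    (U.map fun n => ‖weakDeriv w (u n)‖)
    (Filter.Eventually.of_forall (fun n => ⟨norm_nonneg _, hR n⟩) :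
      ∀ᶠ n in (U : Filter ℕ), ‖weakDeriv w (u n)‖ ∈ Icc 0 R)
  have hr' : Tendsto (fun n => ‖weakDeriv w (u n)‖) U (𝓝 r) := hr
  obtain ⟨g, hg⟩ := exists_weak_limit hR U
  refine ⟨r, hr', g, fun φ hφ hφ0 => ?_, ?_⟩
  · have c : Continuous fun z => fderiv ℝ φ z w :=
      (hφ.continuous_fderiv (by simp)).clm_apply continuous_const
    obtain ⟨p, hp⟩ := exists_inner_eq_integral_smul hφ.continuous hφ0
    obtain ⟨q, hq⟩ := exists_inner_eq_integral_smul c (hasCompactSupport_fderiv_apply hφ0 w)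
    have e := fun n => isWeakDeriv_weakDeriv (hu n) φ hφ hφ0
    simp only [hp, hq] at e ⊢
    have h1 : Tendsto (fun n => inner ℂ q (u n)) U (𝓝 (inner ℂ q v)) :=
      tendsto_const_nhds.inner h
    exact tendsto_nhds_unique h1 (by simpa only [e] using (hg p).neg)
  · have h1 := (Complex.continuous_re.tendsto _).comp (hg g)
    have h2 : Tendsto (fun n => ‖g‖ * ‖weakDeriv w (u n)‖) U (𝓝 (‖g‖ * r)) := hr'.const_mul _
    have h3 := le_of_tendsto_of_tendsto' h1 h2 fun n =>
      (Complex.re_le_norm _).trans (norm_inner_le_norm _ _)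
    have h4 : (inner ℂ g g : ℂ).re = ‖g‖ ^ 2 := by
      rw [inner_self_eq_norm_sq_to_K]
      norm_cast
    rw [h4] at h3
    have hr0 : 0 ≤ r := ge_of_tendsto' hr' fun n => norm_nonneg _
    rcases (norm_nonneg g).eq_or_lt with h0 | h0
    · rw [← h0]
      exact hr0
    · nlinarith

/-- The norm of `W^{1,2}` is lower semicontinuous with respect to convergence in `L²`. -/
theorem memW12_of_tendsto {u : ℕ → L2 d} {v : L2 d} (hu : ∀ n, MemW12 (u n))
    (h : Tendsto u atTop (𝓝 v)) {B : ℕ → ℝ} {B₀ : ℝ} (hB : Tendsto B atTop (𝓝 B₀))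
    (hle : ∀ n, w12Norm (u n) ≤ B n) : MemW12 v ∧ w12Norm v ≤ B₀ := by
  obtain ⟨R, hR⟩ := hB.bddAbove_range
  have hR' : ∀ n, w12Norm (u n) ≤ R := fun n => (hle n).trans (hR (mem_range_self n))
  -- A single ultrafilter serves all directions at once, so the limits of the partial derivative
  -- norms add up to the limit of the squared Sobolev norm.
  let U : Ultrafilter ℕ := hyperfilter ℕ
  have hU : (U : Filter ℕ) ≤ atTop := Nat.hyperfilter_le_atTop
  have hX := fun i => exists_isWeakDeriv_of_tendsto (w := dirX i) (R := R) (fun n => (hu n i).1)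
    (fun n => (norm_weakDeriv_dirX_le _ i).trans (hR' n)) U (h.mono_left hU)
  have hV := fun i => exists_isWeakDeriv_of_tendsto (w := dirV i) (R := R) (fun n => (hu n i).2)
    (fun n => (norm_weakDeriv_dirV_le _ i).trans (hR' n)) U (h.mono_left hU)
  choose rX hrX gX hgX hgX' using hX
  choose rV hrV gV hgV hgV' using hV
  refine ⟨fun i => ⟨⟨_, hgX i⟩, ⟨_, hgV i⟩⟩, ?_⟩
  have hB0 : 0 ≤ B₀ := ge_of_tendsto' hB fun n => (w12Norm_nonneg _).trans (hle n)
  have lim : Tendsto (fun n => w12Norm (u n) ^ 2) U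
      (𝓝 (‖v‖ ^ 2 + ∑ i, rX i ^ 2 + ∑ i, rV i ^ 2)) := by
    simp only [w12Norm_sq]
    exact ((((h.mono_left hU).norm).pow 2).add (tendsto_finsetSum _ fun i _ => (hrX i).pow 2)).add
      (tendsto_finsetSum _ fun i _ => (hrV i).pow 2)
  have hle2 := le_of_tendsto_of_tendsto' lim ((hB.mono_left hU).pow 2) fun n =>
    pow_le_pow_left₀ (w12Norm_nonneg _) (hle n) 2
  refine (pow_le_pow_iff_left₀ (w12Norm_nonneg _) hB0 two_ne_zero).1 (le_trans ?_ hle2)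
  rw [w12Norm_sq]
  gcongr with i _ i _
  · rw [(hgX i).weakDeriv_eq]
    exact hgX' i
  · rw [(hgV i).weakDeriv_eq]
    exact hgV' i

end HamiltonVlasov

namespace HamiltonVlasov

variable {d : ℕ}

/-! ### Comparison of the growth rates -/

/-- Let `B` be the quotient. If `c ≥ 1/12`, then `1/4 ≤ 3c + 3c²`, which is what `y ≤ 2B` requires,
and `2B ≤ 1 + B²`. If `c ≤ 1/12`, then `1 + 2c ≤ 7/6`, so `B ≥ 3y²/7`, and `y ≤ 1 + 9y⁴/49` remains;
this is tightest near `y = 11/10`, whence the squares supplied. -/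
theorem le_one_add_sq_div {c : ℝ} (hc : 0 ≤ c) (y : ℝ) :
    y ≤ 1 + ((2 * c + 2 * c ^ 2 + y ^ 2 / 2) / (1 + 2 * c)) ^ 2 := by
  set B := (2 * c + 2 * c ^ 2 + y ^ 2 / 2) / (1 + 2 * c) with hB
  have hBe : B * (1 + 2 * c) = 2 * c + 2 * c ^ 2 + y ^ 2 / 2 := by
    rw [hB]
    field_simp
  rcases le_total c (1 / 12) with h | h
  · have h1 : 3 / 7 * y ^ 2 ≤ B := by
      rw [hB, le_div_iff₀ (by positivity)]
      nlinarith [sq_nonneg y, mul_nonneg (sub_nonneg.2 h) (sq_nonneg y)]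
    have h2 : (3 / 7 * y ^ 2) ^ 2 ≤ B ^ 2 := pow_le_pow_left₀ (by positivity) h1 2
    nlinarith [sq_nonneg (y ^ 2 - 6 / 5), sq_nonneg (y - 11 / 10)]
  · have h1 : y ≤ 2 * B := by
      have h2 : y * (1 + 2 * c) ≤ 2 * B * (1 + 2 * c) := by
        nlinarith [sq_nonneg (y - (1 + 2 * c) / 2)]
      exact le_of_mul_le_mul_right h2 (by positivity)
    nlinarith [sq_nonneg (B - 1)]

/-- With `c = C M²` and `y = 2c exp((1/2 + c) t)` one has `y²/2 = 2c² exp((1 + 2c) t)`, and the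
quotient in `le_one_add_sq_div` is exactly `2 C M Q_M(t)`. -/
theorem rate_le {C M : ℝ} (hC : 0 ≤ C) (t : ℝ) :
    2 * C * M ^ 2 * Real.exp ((1 / 2 + C * M ^ 2) * t)
      ≤ 1 + 4 * C ^ 2 * M ^ 2 * boundQ C M t ^ 2 := by
  have hc : 0 ≤ C * M ^ 2 := by positivity
  have hX := Real.exp_pos ((1 / 2 + C * M ^ 2) * t)
  refine (le_one_add_sq_div hc (2 * C * M ^ 2 * Real.exp ((1 / 2 + C * M ^ 2) * t))).trans_eq ?_
  have e : Real.exp ((1 + 2 * C * M ^ 2) * t) = Real.exp ((1 / 2 + C * M ^ 2) * t) ^ 2 := by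
    rw [← Real.exp_nat_mul]
    congr 1
    push_cast
    ring
  rw [boundQ, e]
  have h1 : (1 : ℝ) + 2 * (C * M ^ 2) ≠ 0 := by positivity
  have h2 : (1 : ℝ) + 2 * C * M ^ 2 ≠ 0 := by
    rw [mul_assoc]
    exact h1
  field_simp
  ring

/-- The exponent is doubled and `N` raised to `M`. Then `(1 + 2c) E ≤ 1 + c + (1 + 3c) E` suffices,
with `c = C M²` and `E` the exponential. -/
theorem mul_exp_le_boundR {C N M t : ℝ} (hC : 0 ≤ C) (hN : 0 ≤ N) (hNM : N ≤ M) (ht : 0 ≤ t) :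
    N * Real.exp ((1 / 2 + C * N ^ 2) * t) ≤ boundR C M t := by
  have hM : 0 ≤ M := hN.trans hNM
  have hc : 0 ≤ C * M ^ 2 := by positivity
  have h1 : N * Real.exp ((1 / 2 + C * N ^ 2) * t)
      ≤ M * Real.exp ((1 + 2 * C * M ^ 2) * t) := by
    have h2 : C * N ^ 2 ≤ C * M ^ 2 := by gcongr
    have h3 : 1 / 2 + C * N ^ 2 ≤ 1 + 2 * C * M ^ 2 := by linarith
    exact mul_le_mul hNM (Real.exp_le_exp.2 (mul_le_mul_of_nonneg_right h3 ht))
      (Real.exp_pos _).le hM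
  refine h1.trans ?_
  have hE := Real.exp_pos ((1 + 2 * C * M ^ 2) * t)
  rw [boundR, le_div_iff₀ (by linarith), mul_assoc]
  gcongr
  nlinarith [mul_nonneg hc hE.le]

/-! ### Estimates for classical solutions -/

section Classical

variable {Γ : Space d → ℝ} (hΓ : RegularPotential Γ) {u v : ℝ → L2 d}
include hΓ

omit hΓ in
theorem IsClassicalSolution.memW12 (hu : IsClassicalSolution Γ u) {t : ℝ} (ht : 0 ≤ t) :
    MemW12 (u t) := by
  obtain ⟨a, ha, hua⟩ := hu.exists_isFlow
  exact (ha.isC1Compact t).memW12 (hua t ht)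

/-- Mass is constant and the squared gradient grows at rate at most `1 + 2 C N²`. Taking the square
root halves this rate. -/
theorem IsClassicalSolution.w12Norm_le (hu : IsClassicalSolution Γ u) {t : ℝ} (ht : 0 ≤ t) :
    w12Norm (u t)
      ≤ w12Norm (u 0) * Real.exp ((1 / 2 + potConst Γ * w12Norm (u 0) ^ 2) * t) := by
  obtain ⟨a, ha, hua⟩ := hu.exists_isFlow
  have hC := hΓ.potConst_nonneg
  have e0 := (ha.isC1Compact 0).w12Norm_sq_eq (hua 0 le_rfl)
  have et := (ha.isC1Compact t).w12Norm_sq_eq (hua t ht)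
  have hg := ha.gradSq_le hΓ ht
  have h0 := add_nonneg (xGradSq_nonneg (a 0)) (vGradSq_nonneg (a 0))
  have hm := massSq_nonneg (a 0)
  have hle : massSq (a 0) ≤ w12Norm (u 0) ^ 2 := by linarith
  set N := w12Norm (u 0)
  have hN : 0 ≤ N := w12Norm_nonneg _
  have hE : Real.exp ((1 + 2 * potConst Γ * massSq (a 0)) * t)
      ≤ Real.exp ((1 + 2 * potConst Γ * N ^ 2) * t) := by gcongr
  have h1 : 1 ≤ Real.exp ((1 + 2 * potConst Γ * N ^ 2) * t) := Real.one_le_exp (by positivity)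
  refine (pow_le_pow_iff_left₀ (w12Norm_nonneg _) (by positivity) two_ne_zero).1 ?_
  have e : Real.exp ((1 / 2 + potConst Γ * N ^ 2) * t) ^ 2
      = Real.exp ((1 + 2 * potConst Γ * N ^ 2) * t) := by
    rw [← Real.exp_nat_mul]
    congr 1
    push_cast
    ring
  have h2 := mul_le_mul_of_nonneg_left hE h0
  have h3 := mul_le_mul_of_nonneg_left h1 hm
  rw [mul_pow, e, et, ha.massSq_eq hΓ ht]
  calc massSq (a 0) + (xGradSq (a t) + vGradSq (a t))
      ≤ (massSq (a 0) + (xGradSq (a 0) + vGradSq (a 0)))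
        * Real.exp ((1 + 2 * potConst Γ * N ^ 2) * t) := by linarith
    _ = _ := by rw [← e0]

theorem IsFlow.sqrt_vGradSq_le {a : ℝ → PhaseSpace d → ℂ} (ha : IsFlow Γ a) {M : ℝ}
    (hM : massSq (a 0) + (xGradSq (a 0) + vGradSq (a 0)) ≤ M ^ 2) {t : ℝ} (ht : 0 ≤ t) :
    √(vGradSq (a t)) ≤ √(xGradSq (a 0) + vGradSq (a 0)) *
      Real.exp ((1 / 2 + potConst Γ * M ^ 2) * t) := by
  have hC := hΓ.potConst_nonneg
  have hg := ha.gradSq_le hΓ ht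
  have h0 := add_nonneg (xGradSq_nonneg (a 0)) (vGradSq_nonneg (a 0))
  refine Real.sqrt_le_iff.2 ⟨by positivity, ?_⟩
  rw [mul_pow, Real.sq_sqrt h0, ← Real.exp_nat_mul]
  refine (le_add_of_nonneg_left (xGradSq_nonneg (a t))).trans (hg.trans ?_)
  have h1 : massSq (a 0) ≤ M ^ 2 := by linarith
  have h2 := mul_le_mul_of_nonneg_right (mul_le_mul_of_nonneg_left h1 hC) ht
  refine mul_le_mul_of_nonneg_left (Real.exp_le_exp.2 ?_) h0
  push_cast
  linarith

theorem IsClassicalSolution.norm_sub_le (hu : IsClassicalSolution Γ u)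
    (hv : IsClassicalSolution Γ v) {M : ℝ} (huM : w12Norm (u 0) ≤ M) (hvM : w12Norm (v 0) ≤ M)
    {t : ℝ} (ht : 0 ≤ t) :
    ‖u t - v t‖ ≤ ‖u 0 - v 0‖ * Real.exp (∫ τ in (0 : ℝ)..t,
      2 * potConst Γ * M ^ 2 * Real.exp ((1 / 2 + potConst Γ * M ^ 2) * τ)) := by
  obtain ⟨a, ha, hua⟩ := hu.exists_isFlow
  obtain ⟨b, hb, hvb⟩ := hv.exists_isFlow
  have hC := hΓ.potConst_nonneg
  have ea := (ha.isC1Compact 0).w12Norm_sq_eq (hua 0 le_rfl)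
  have eb := (hb.isC1Compact 0).w12Norm_sq_eq (hvb 0 le_rfl)
  have ma : massSq (a 0) + (xGradSq (a 0) + vGradSq (a 0)) ≤ M ^ 2 := by
    rw [← ea]
    exact pow_le_pow_left₀ (w12Norm_nonneg _) huM 2
  have mb : massSq (b 0) + (xGradSq (b 0) + vGradSq (b 0)) ≤ M ^ 2 := by
    rw [← eb]
    exact pow_le_pow_left₀ (w12Norm_nonneg _) hvM 2
  have hsub : ∀ s, 0 ≤ s → ‖u s - v s‖ ^ 2 = massSq fun z => a s z - b s z := fun s hs =>
    norm_sq_eq_integral ((Lp.coeFn_sub _ _).trans ((hua s hs).sub (hvb s hs)))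
  have h := ha.massSq_sub_le hb hΓ
    -- Twice the final rate, since Grönwall is applied to the square of the norm.
    (κ := fun τ => 2 * (2 * potConst Γ * M ^ 2 * Real.exp ((1 / 2 + potConst Γ * M ^ 2) * τ)))
    (by fun_prop) (fun τ => by positivity) (fun s hs => by
      have h1 := IsFlow.sqrt_vGradSq_le hΓ ha ma hs
      have h2 := IsFlow.sqrt_vGradSq_le hΓ hb mb hs
      rw [ha.massSq_eq hΓ hs, hb.massSq_eq hΓ hs]
      set X := Real.exp ((1 / 2 + potConst Γ * M ^ 2) * s)
      have hX : 0 < X := Real.exp_pos _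
      have h3 : (√(massSq (a 0)) + √(massSq (b 0))) *
          (√(xGradSq (a 0) + vGradSq (a 0)) + √(xGradSq (b 0) + vGradSq (b 0))) ≤ 2 * M ^ 2 := by
        have s1 := Real.sq_sqrt (massSq_nonneg (a 0))
        have s2 := Real.sq_sqrt (massSq_nonneg (b 0))
        have s3 := Real.sq_sqrt (add_nonneg (xGradSq_nonneg (a 0)) (vGradSq_nonneg (a 0)))
        have s4 := Real.sq_sqrt (add_nonneg (xGradSq_nonneg (b 0)) (vGradSq_nonneg (b 0)))
        set p := √(massSq (a 0))
        set q := √(massSq (b 0))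
        set r := √(xGradSq (a 0) + vGradSq (a 0))
        set w := √(xGradSq (b 0) + vGradSq (b 0))
        -- The chain is `(p + q)(r + w) ≤ ½((p + q)² + (r + w)²) ≤ p² + q² + r² + w² ≤ 2M²`: mass
        -- and gradient share one budget `M²` for each solution.
        nlinarith [sq_nonneg (p + q - (r + w)), sq_nonneg (p - q), sq_nonneg (r - w)]
      have h4 : (√(massSq (a 0)) + √(massSq (b 0))) * (√(vGradSq (a s)) + √(vGradSq (b s)))
          ≤ 2 * M ^ 2 * X := by
        refine le_trans ?_ (mul_le_mul_of_nonneg_right h3 hX.le)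
        rw [mul_assoc, add_mul _ _ X]
        gcongr
      have h5 := mul_le_mul_of_nonneg_left h4 (mul_nonneg zero_le_two hC)
      linarith) ht
  rw [intervalIntegral.integral_const_mul, ← hsub t ht, ← hsub 0 le_rfl] at h
  refine (pow_le_pow_iff_left₀ (norm_nonneg _) (by positivity) two_ne_zero).1 ?_
  rw [mul_pow, ← Real.exp_nat_mul]
  exact_mod_cast h

end Classical

end HamiltonVlasov

/-! ### Passage to the limit -/

open HamiltonVlasov in
theorem corollary3p7 (d : ℕ) (Γ : HamiltonVlasov.Space d → ℝ)
    (hΓ : HamiltonVlasov.RegularPotential Γ) :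
    (∀ (M : ℝ) (α : ℝ → HamiltonVlasov.L2 d),
      HamiltonVlasov.IsSolution Γ α → HamiltonVlasov.w12Norm (α 0) ≤ M →
      ∀ t : ℝ, 0 ≤ t →
        HamiltonVlasov.MemW12 (α t) ∧
        HamiltonVlasov.w12Norm (α t) ≤
          HamiltonVlasov.boundR (HamiltonVlasov.potConst Γ) M t) ∧
    (∀ (M : ℝ), 0 < M → ∀ (α₀ β₀ : HamiltonVlasov.L2 d),
      HamiltonVlasov.MemW12 α₀ → HamiltonVlasov.MemW12 β₀ →
      HamiltonVlasov.w12Norm α₀ ≤ M → HamiltonVlasov.w12Norm β₀ ≤ M →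
      ∀ α β : ℝ → HamiltonVlasov.L2 d,
        HamiltonVlasov.IsSolution Γ α → α 0 = α₀ →
        HamiltonVlasov.IsSolution Γ β → β 0 = β₀ →
      ∀ t : ℝ, 0 ≤ t →
        ‖α t - β t‖ ≤ ‖α₀ - β₀‖ *
          Real.exp (∫ τ in (0 : ℝ)..t,
            (1 + 4 * HamiltonVlasov.potConst Γ ^ 2 * M ^ 2 *
              HamiltonVlasov.boundQ (HamiltonVlasov.potConst Γ) M τ ^ 2))) := by
  have hC := hΓ.potConst_nonneg
  refine ⟨fun M α hα hM t ht => ?_, ?_⟩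
  · obtain ⟨hα0, u, hu, hconv, hunif⟩ := hα
    have hN := tendsto_w12Norm (fun n => (hu n).memW12 le_rfl) hα0 hconv
    have hB : Tendsto (fun n => w12Norm (u n 0) *
        Real.exp ((1 / 2 + potConst Γ * w12Norm (u n 0) ^ 2) * t)) atTop
        (𝓝 (w12Norm (α 0) * Real.exp ((1 / 2 + potConst Γ * w12Norm (α 0) ^ 2) * t))) :=
      ((by fun_prop : Continuous fun N : ℝ =>
        N * Real.exp ((1 / 2 + potConst Γ * N ^ 2) * t)).tendsto _).comp hN
    obtain ⟨h1, h2⟩ := memW12_of_tendsto (fun n => (hu n).memW12 ht)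
      ((hunif t).tendsto_at ⟨ht, le_rfl⟩) hB fun n => (hu n).w12Norm_le hΓ ht
    exact ⟨h1, h2.trans (mul_exp_le_boundR hC (w12Norm_nonneg _) hM ht)⟩
  · rintro M - α₀ β₀ - - hαM hβM α β hα rfl hβ rfl t ht
    obtain ⟨hα0, u, hu, hconvu, hunifu⟩ := hα
    obtain ⟨hβ0, v, hv, hconvv, hunifv⟩ := hβ
    have hNu := tendsto_w12Norm (fun n => (hu n).memW12 le_rfl) hα0 hconvu
    have hNv := tendsto_w12Norm (fun n => (hv n).memW12 le_rfl) hβ0 hconvv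
    -- The approximating initial values may exceed `M` in norm. The classical estimate is therefore
    -- used with bounds decreasing to `M` only in the limit, and the exponential factor is
    -- continuous in the bound.
    have hMn : Tendsto (fun n => max M (max (w12Norm (u n 0)) (w12Norm (v n 0)))) atTop (𝓝 M) := by
      have h := (tendsto_const_nhds (x := M)).max (hNu.max hNv)
      rwa [max_eq_left (max_le hαM hβM)] at h
    have hI : Continuous fun M : ℝ => Real.exp (∫ τ in (0 : ℝ)..t,
        2 * potConst Γ * M ^ 2 * Real.exp ((1 / 2 + potConst Γ * M ^ 2) * τ)) :=
      Real.continuous_exp.comp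
        (intervalIntegral.continuous_parametric_intervalIntegral_of_continuous' (by fun_prop) 0 t)
    have lim : ∀ {s : ℝ}, 0 ≤ s →
        Tendsto (fun n => ‖u n s - v n s‖) atTop (𝓝 ‖α s - β s‖) := fun hs =>
      (((hunifu _).tendsto_at ⟨hs, le_rfl⟩).sub ((hunifv _).tendsto_at ⟨hs, le_rfl⟩)).norm
    have h1 := le_of_tendsto_of_tendsto' (lim ht) ((lim le_rfl).mul ((hI.tendsto M).comp hMn))
      fun n => (hu n).norm_sub_le hΓ (hv n) ((le_max_left _ _).trans (le_max_right _ _))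
        ((le_max_right _ _).trans (le_max_right _ _)) ht
    refine h1.trans ?_
    gcongr
    refine intervalIntegral.integral_mono_on ht
      (Continuous.intervalIntegrable (by fun_prop) _ _)
      (Continuous.intervalIntegrable (by unfold boundQ; fun_prop) _ _) fun τ _ => rate_le hC τ
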